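/- Let $X$ be a (Hausdorff) smooth real manifold of dimension $2n+1$, $n\ge 0$, with a CR structure of hypersurface type: a smooth complex subbundle $T_{1,0}X\subset \mathbb{C}\otimes TX$ of rank $n$ which is formally integrable (commutators of smooth local sections are again sections) and satisfies $T_{1,0}X\cap T_{0,1}X=0$, where $T_{0,1}X:=\overline{T_{1,0}X}$. Let $HX:=\Re(T_{1,0}X)\subset TX$ be its horizontal bundle. Let $\mu$ be a smooth positive measure on $X$ (a measure with smooth positive density with respect to Lebesgue measure in local coordinates), and for a smooth complex vector field $Z$ on $X$ let $Z^\dagger$ be its formal adjoint, defined by $\int_X f\,Z^\dagger\varphi\,d\mu=\int_X \varphi\,Zf\,d\mu$ for all $f\in C^\infty(X;\mathbb{C})$ and $\varphi\in C^\infty_c(X;\mathbb{C})$. Let $\sigma$ be a regular complex Borel measure on $X$ which is CR, that is, $\int_X Z^\dagger\varphi\,d\sigma=0$ for every smooth section $Z$ of $T_{0,1}X$ and every $\varphi\in C_c^\infty(X;\mathbb{C})$. Let $M\subset X$ be a connected smooth embedded submanifold of positive codimension such that the restriction $\sigma_{|M}$ is not the zero measure. Then $M$ has codimension one in $X$, and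 $M$ is characteristic at every point of the support of $\sigma_{|M}$ (that is, of its total variation): $T_xM=H_xX$ for every $x\in M$ in the support of $\sigma_{|M}$. -/

import Mathlib

open scoped Manifold ContDiff TensorProduct
open MeasureTheory

noncomputable section

namespace CRGeometry

section Bundle

variable {N : ℕ} {X : Type*} [TopologicalSpace X] [ChartedSpace (EuclideanSpace ℝ (Fin N)) X]

variable (N) in
/-- The fibre at `x` of the complexified tangent bundle `ℂ ⊗ TX` of an `N`-dimensional manifold. -/
abbrev ComplexTangentSpace (x : X) : Type :=
  ℂ ⊗[ℝ] TangentSpace (𝓡 N) x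

/-- The complex tangent vector `u + i v`. -/
def toComplexTangent {x : X} (u v : TangentSpace (𝓡 N) x) : ComplexTangentSpace N x :=
  (1 : ℂ) ⊗ₜ[ℝ] u + Complex.I ⊗ₜ[ℝ] v

variable (N) in
/-- The real part `ℂ ⊗ T_x X → T_x X`, sending `u + i v` to `u`. -/
def rePart (x : X) : ComplexTangentSpace N x →ₗ[ℝ] TangentSpace (𝓡 N) x :=
  (TensorProduct.lid ℝ (TangentSpace (𝓡 N) x)).toLinearMap ∘ₗ
    Complex.reLm.rTensor (TangentSpace (𝓡 N) x)

variable (N) in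
/-- The imaginary part `ℂ ⊗ T_x X → T_x X`, sending `u + i v` to `v`. -/
def imPart (x : X) : ComplexTangentSpace N x →ₗ[ℝ] TangentSpace (𝓡 N) x :=
  (TensorProduct.lid ℝ (TangentSpace (𝓡 N) x)).toLinearMap ∘ₗ
    Complex.imLm.rTensor (TangentSpace (𝓡 N) x)

variable (N) in
/-- Complex conjugation on `ℂ ⊗ T_x X`, sending `u + i v` to `u - i v`. -/
def conjTangent (x : X) : ComplexTangentSpace N x →ₗ[ℝ] ComplexTangentSpace N x :=
  Complex.conjAe.toLinearMap.rTensor (TangentSpace (𝓡 N) x)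

theorem conjTangent_smul {x : X} (c : ℂ) (z : ComplexTangentSpace N x) :
    conjTangent N x (c • z) = (starRingEnd ℂ c) • conjTangent N x z := by
  induction z using TensorProduct.induction_on with
  | zero => simp
  | tmul d u => simp [conjTangent, TensorProduct.smul_tmul']
  | add a b ha hb => simp only [smul_add, map_add, ha, hb]

/-- The conjugate of a complex subspace of `ℂ ⊗ T_x X`. -/
def conjSubmodule {x : X} (V : Submodule ℂ (ComplexTangentSpace N x)) :
    Submodule ℂ (ComplexTangentSpace N x) where
  carrier := {z | conjTangent N x z ∈ V}
  add_mem' := by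
    intro a b ha hb
    simpa using V.add_mem ha hb
  zero_mem' := by simp
  smul_mem' := by
    intro c z hz
    simpa [conjTangent_smul] using V.smul_mem (starRingEnd ℂ c) hz

variable [IsManifold (𝓡 N) ∞ X]

/-- A complex vector field is smooth on `U` if its real and imaginary parts are. -/
def IsSmoothFieldOn (Z : ∀ x : X, ComplexTangentSpace N x) (U : Set X) : Prop :=
  ContMDiffOn (𝓡 N) (𝓡 N).tangent ∞
      (fun x => (⟨x, rePart N x (Z x)⟩ : TangentBundle (𝓡 N) X)) U ∧
    ContMDiffOn (𝓡 N) (𝓡 N).tangent ∞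
      (fun x => (⟨x, imPart N x (Z x)⟩ : TangentBundle (𝓡 N) X)) U

/-- The commutator of complex vector fields: the complex bilinear extension
`[A + iB, C + iD] = ([A, C] - [B, D]) + i ([A, D] + [B, C])` of the Lie bracket. -/
def complexLieBracket (Z W : ∀ x : X, ComplexTangentSpace N x) (x : X) :
    ComplexTangentSpace N x :=
  toComplexTangent
    (VectorField.mlieBracket (𝓡 N) (fun y => rePart N y (Z y)) (fun y => rePart N y (W y)) x -
      VectorField.mlieBracket (𝓡 N) (fun y => imPart N y (Z y)) (fun y => imPart N y (W y)) x)
    (VectorField.mlieBracket (𝓡 N) (fun y => rePart N y (Z y)) (fun y => imPart N y (W y)) x +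
      VectorField.mlieBracket (𝓡 N) (fun y => imPart N y (Z y)) (fun y => rePart N y (W y)) x)

/-- The derivative `Z f` of a complex valued function along a complex vector field. -/
def fieldDeriv (Z : ∀ x : X, ComplexTangentSpace N x) (f : X → ℂ) (x : X) : ℂ :=
  let df : TangentSpace (𝓡 N) x →L[ℝ] ℂ := mfderiv (𝓡 N) 𝓘(ℝ, ℂ) f x
  df (rePart N x (Z x)) + Complex.I * df (imPart N x (Z x))

variable (N X) in
/-- A CR structure of rank `n` on an `N`-dimensional manifold `X`: a smooth complex subbundle
`T_{1,0}X` of rank `n` of the complexified tangent bundle which is formally integrable and meets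
its conjugate only in zero. It is of hypersurface type if `N = 2 * n + 1`. -/
structure CRStructure (n : ℕ) where
  /-- the fibres of `T_{1,0}X` -/
  T10 : ∀ x : X, Submodule ℂ (ComplexTangentSpace N x)
  exists_local_frame : ∀ x₀ : X, ∃ U : Set X, IsOpen U ∧ x₀ ∈ U ∧
    ∃ Z : Fin n → ∀ x : X, ComplexTangentSpace N x, (∀ j, IsSmoothFieldOn (Z j) U) ∧
      ∀ x ∈ U, LinearIndependent ℂ (fun j => Z j x) ∧
        Submodule.span ℂ (Set.range fun j => Z j x) = T10 x
  involutive : ∀ U : Set X, IsOpen U → ∀ Z W : ∀ x : X, ComplexTangentSpace N x,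
    IsSmoothFieldOn Z U → IsSmoothFieldOn W U →
    (∀ x ∈ U, Z x ∈ T10 x) → (∀ x ∈ U, W x ∈ T10 x) →
    ∀ x ∈ U, complexLieBracket Z W x ∈ T10 x
  disjoint_conj : ∀ x : X, Disjoint (T10 x) (conjSubmodule (T10 x))

namespace CRStructure

variable {n : ℕ} (S : CRStructure N X n)

/-- The conjugate bundle `T_{0,1}X`. -/
def T01 (x : X) : Submodule ℂ (ComplexTangentSpace N x) :=
  conjSubmodule (S.T10 x)

/-- The horizontal bundle `HX`, consisting of the real parts of vectors of `T_{1,0}X`. -/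
def horizontal (x : X) : Submodule ℝ (TangentSpace (𝓡 N) x) :=
  ((S.T10 x).restrictScalars ℝ).map (rePart N x)

end CRStructure

end Bundle

section Measures

variable {N : ℕ} {X : Type*} [TopologicalSpace X] [ChartedSpace (EuclideanSpace ℝ (Fin N)) X]
  [IsManifold (𝓡 N) ∞ X] [MeasurableSpace X]

variable (N) in
/-- A measure that has, in all local coordinates, a smooth positive density with respect to
Lebesgue measure. -/
def IsSmoothPositiveMeasure (μ : Measure X) : Prop :=
  ∀ e ∈ IsManifold.maximalAtlas (𝓡 N) ∞ X, ∃ ρ : EuclideanSpace ℝ (Fin N) → ℝ,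
    ContDiffOn ℝ ∞ ρ e.target ∧ (∀ y ∈ e.target, 0 < ρ y) ∧
      (μ.restrict e.source).map e =
        (volume.restrict e.target).withDensity fun y => ENNReal.ofReal (ρ y)

variable (N) in
/-- A smooth complex valued function with compact support. -/
def IsTestFunction (φ : X → ℂ) : Prop :=
  ContMDiff (𝓡 N) 𝓘(ℝ, ℂ) ∞ φ ∧ HasCompactSupport φ

/-- The test function `ψ` is the value at the test function `φ` of the formal adjoint of `Z` with
respect to `μ`, that is `∫ f ψ dμ = ∫ φ (Z f) dμ` for all smooth `f`. If `Z` is smooth and `μ` is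
smooth and positive, then there is exactly one such `ψ`, given in coordinates in which
`μ = m dx` and `Z = ∑ aₖ ∂ₖ` by `ψ = - ∑ aₖ ∂ₖ φ - m⁻¹ (∑ ∂ₖ (m aₖ)) φ`. -/
def IsFormalAdjointValue (μ : Measure X) (Z : ∀ x : X, ComplexTangentSpace N x)
    (φ ψ : X → ℂ) : Prop :=
  IsTestFunction N ψ ∧ ∀ f : X → ℂ, ContMDiff (𝓡 N) 𝓘(ℝ, ℂ) ∞ f →
    ∫ x, f x * ψ x ∂μ = ∫ x, φ x * fieldDeriv Z f x ∂μ

/-- The complex measure `σ` is CR: `Z σ = 0` in the sense of distributions, that is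
`∫ Z† φ dσ = 0` for all test functions `φ`, for every smooth section `Z` of `T_{0,1}X`,
where `Z†` is the formal adjoint of `Z` with respect to `μ`. -/
def IsCRMeasure {n : ℕ} (S : CRStructure N X n) (μ : Measure X) (σ : ComplexMeasure X) : Prop :=
  ∀ Z : ∀ x : X, ComplexTangentSpace N x, IsSmoothFieldOn Z Set.univ → (∀ x, Z x ∈ S.T01 x) →
    ∀ φ ψ : X → ℂ, IsTestFunction N φ → IsFormalAdjointValue μ Z φ ψ →
      ∫ᵛ x, ψ x ∂[ContinuousLinearMap.mul ℝ ℂ; σ] = 0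

end Measures

end CRGeometry

end

/-! Near a point of M in the support of σ|_M, write M as the zero set of a smooth vector-valued map
`r` whose differential at that point has kernel inside the tangent space of M
(`exists_local_defining_function`). The heart of the proof is that every section Z of T_{0,1}X
annihilates `r` there.

By Leibniz, Z†(φg) = g Z†φ − φ Zg. Test the CR condition with g = G_c ∘ r, where G_c(v) = G(cv)/c
and G is compactly supported and equal to a linear form ℓ near 0. As c → ∞, G_c tends to 0
uniformly, while Z(G_c ∘ r) stays bounded on the support of φ and converges to Z(ℓ ∘ r) on {r = 0}
and to 0 elsewhere. Dominated convergence leaves ∫_{r=0} φ Z(ℓ ∘ r) dσ = 0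
(`IsCRMeasure.setIntegral_fieldDeriv_eq_zero`). If Z(ℓ ∘ r) were nonzero at the point, dividing by
it would make σ|_M vanish nearby (`IsCRMeasure.notMem_support_of_fieldDeriv_ne_zero`).

Letting Z and ℓ vary gives HX ⊆ TM at support points. Since HX has rank 2n and dim M < 2n + 1, the
dimension of M is 2n and the two spaces agree. A support point exists because σ is regular and σ|_M
≠ 0.

The CR condition concerns only pairs (φ, Z†φ), so formal adjoints have to be produced: for φ
supported in a chart this is the divergence theorem (`exists_isFormalAdjointValue`). -/

namespace CRGeometry

/-! ### Vanishing criteria and supports for regular complex measures -/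

section ComplexMeasures

variable {X : Type*} [MeasurableSpace X]

theorem isFiniteMeasure_variation_signedMeasure (s : SignedMeasure X) :
    IsFiniteMeasure s.variation := by
  rw [← SignedMeasure.totalVariation_eq_variation]
  unfold SignedMeasure.totalVariation
  infer_instance

theorem variation_le_re_add_im (σ : ComplexMeasure X) :
    σ.variation ≤ (ComplexMeasure.re σ).variation + (ComplexMeasure.im σ).variation := by
  refine VectorMeasure.variation_le_of_forall_enorm_le fun E _ => ?_
  have h : ‖σ E‖ₑ ≤ ‖ComplexMeasure.re σ E‖ₑ + ‖ComplexMeasure.im σ E‖ₑ := by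
    have h1 : ‖σ E‖ ≤ ‖(σ E).re‖ + ‖(σ E).im‖ := Complex.norm_le_abs_re_add_abs_im _
    have h2 : ‖σ E‖₊ ≤ ‖(σ E).re‖₊ + ‖(σ E).im‖₊ := h1
    simp only [enorm_eq_nnnorm]
    exact_mod_cast h2
  exact h.trans (add_le_add (VectorMeasure.enorm_measure_le_variation _ _)
    (VectorMeasure.enorm_measure_le_variation _ _))

/-- Finiteness of the variation makes bounded continuous functions integrable and permits
approximation by compact sets from inside and open sets from outside. -/
theorem isFiniteMeasure_variation_complexMeasure (σ : ComplexMeasure X) :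
    IsFiniteMeasure σ.variation := by
  have := isFiniteMeasure_variation_signedMeasure (ComplexMeasure.re σ)
  have := isFiniteMeasure_variation_signedMeasure (ComplexMeasure.im σ)
  exact isFiniteMeasure_of_le _ (variation_le_re_add_im σ)

variable [TopologicalSpace X] [BorelSpace X] [T2Space X]

/-- A regular complex measure that vanishes on the compact subsets of `W` vanishes on `W`. -/
theorem variation_eq_zero_of_isCompact {ν : ComplexMeasure X} [ν.variation.Regular]
    {W : Set X} (hW : MeasurableSet W) (h : ∀ K ⊆ W, IsCompact K → ν K = 0) :
    ν.variation W = 0 := by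
  have := isFiniteMeasure_variation_complexMeasure ν
  rw [VectorMeasure.variation_apply_eq_zero hW]
  intro t ht htm
  rw [← enorm_eq_zero, ← le_zero_iff]
  refine ENNReal.le_of_forall_pos_le_add fun ε hε _ => ?_
  obtain ⟨K, hKt, hK, hKε⟩ := htm.exists_isCompact_sdiff_lt (μ := ν.variation)
    (measure_ne_top _ _) (ENNReal.coe_pos.2 hε).ne'
  have h1 : ν t = ν K + ν (t \ K) := by
    rw [← VectorMeasure.of_union Set.disjoint_sdiff_right hK.measurableSet
      (htm.diff hK.measurableSet), Set.union_sdiff_cancel hKt]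
  rw [h1, h K (hKt.trans ht) hK, zero_add, zero_add]
  exact (VectorMeasure.enorm_measure_le_variation _ _).trans hKε.le

/-- If the integrals of a sufficiently rich class of functions with support in `W` vanish, then
so does the measure on `W`. -/
theorem variation_eq_zero_of_forall_integral {ν : ComplexMeasure X} [ν.variation.Regular]
    {W : Set X} (hW : IsOpen W)
    (h : ∀ K V : Set X, IsCompact K → IsOpen V → K ⊆ V → V ⊆ W → ∃ φ : X → ℂ, Continuous φ ∧
      (∀ x ∈ K, φ x = 1) ∧ (∀ x, ‖φ x‖ ≤ 1) ∧ (∀ x ∉ V, φ x = 0) ∧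
      ∫ᵛ x, φ x ∂[ContinuousLinearMap.mul ℝ ℂ; ν] = 0) :
    ν.variation W = 0 := by
  have := isFiniteMeasure_variation_complexMeasure ν
  refine variation_eq_zero_of_isCompact hW.measurableSet fun K hKW hK => ?_
  rw [← enorm_eq_zero, ← le_zero_iff]
  refine ENNReal.le_of_forall_pos_le_add fun ε hε _ => ?_
  obtain ⟨V, hKV, hV, hVε⟩ := hK.measurableSet.exists_isOpen_sdiff_lt (μ := ν.variation)
    (measure_ne_top _ _) (ENNReal.coe_pos.2 hε).ne'
  obtain ⟨φ, hφ, hφK, hφ1, hφV, hφi⟩ := h K (V ∩ W) hK (hV.inter hW)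
    (Set.subset_inter hKV hKW) Set.inter_subset_right
  have hint : Integrable φ ν.variation :=
    Integrable.of_bound hφ.aestronglyMeasurable 1 (Filter.Eventually.of_forall hφ1)
  -- As `φ = 1` on `K`, the integral over `K` is `ν K`. The total integral is zero, so `ν K` is
  -- minus the integral over `Kᶜ`, which is at most the variation of `V \ K`.
  have h1 : ∫ᵛ x in K, φ x ∂[ContinuousLinearMap.mul ℝ ℂ; ν] = ν K := by
    rw [VectorMeasure.setIntegral_congr_fun (g := fun _ => (1 : ℂ)) hφK]
    have := isFiniteMeasure_variation_complexMeasure (ν.restrict K)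
    rw [VectorMeasure.integral_const]
    simp [VectorMeasure.restrict_apply, hK.measurableSet]
  have h2 := VectorMeasure.setIntegral_add_compl (B := ContinuousLinearMap.mul ℝ ℂ)
    hK.measurableSet hint
  rw [hφi, h1] at h2
  rw [eq_neg_of_add_eq_zero_left h2, enorm_neg, zero_add]
  refine VectorMeasure.enorm_setIntegral_le_lintegral_enorm.trans ?_
  have h3 : ‖ContinuousLinearMap.mul ℝ ℂ‖ₑ ≤ 1 := by
    rw [← ofReal_norm, ContinuousLinearMap.opNorm_mul]; simp
  calc _ ≤ 1 * ∫⁻ x in Kᶜ, (V \ K).indicator 1 x ∂ν.variation := by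
        refine mul_le_mul' h3 ?_
        refine setLIntegral_mono' hK.measurableSet.compl fun x hx => ?_
        by_cases hxV : x ∈ V
        · rw [Set.indicator_of_mem (show x ∈ V \ K from ⟨hxV, hx⟩), ← ofReal_norm, Pi.one_apply]
          exact ENNReal.ofReal_le_one.2 (hφ1 x)
        · simp [hφV x fun h => hxV h.1]
    _ ≤ ∫⁻ x, (V \ K).indicator 1 x ∂ν.variation := by
        rw [one_mul]; exact setLIntegral_le_lintegral _ _
    _ = ν.variation (V \ K) := lintegral_indicator_one (hV.measurableSet.diff hK.measurableSet)
    _ ≤ ε := hVε.2.le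

theorem exists_mem_support_variation_restrict {σ : ComplexMeasure X} [σ.variation.Regular]
    {s : Set X} (hs : σ.restrict s ≠ 0) :
    MeasurableSet s ∧ (σ.restrict s).variation.Regular ∧
      ∃ x ∈ s, x ∈ (σ.restrict s).variation.support := by
  -- Restriction to a non-measurable set is zero by convention, so a nonzero restriction forces
  -- measurability.
  have hsm : MeasurableSet s := by
    by_contra h
    exact hs (VectorMeasure.restrict_not_measurable _ h)
  have := isFiniteMeasure_variation_complexMeasure σ
  have hreg : (σ.restrict s).variation.Regular := by
    rw [VectorMeasure.variation_restrict hsm]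
    exact Measure.Regular.restrict_of_measure_ne_top (measure_ne_top _ _)
  refine ⟨hsm, hreg, ?_⟩
  by_contra! hcon
  refine hs (VectorMeasure.variation_eq_zero.1 ?_)
  rw [← Measure.measure_univ_eq_zero]
  have h1 : (σ.restrict s).variation sᶜ = 0 := by
    rw [VectorMeasure.variation_restrict hsm, Measure.restrict_apply hsm.compl]
    simp
  -- Regularity, rather than second countability of `X`, makes the complement of the support null.
  have h2 : (σ.restrict s).variation ((σ.restrict s).variation.support)ᶜ = 0 :=
    Measure.measure_compl_support_of_regular
  refine measure_mono_null ?_ (measure_union_null h1 h2)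
  intro x _
  by_cases hx : x ∈ s
  · exact Or.inr (hcon x hx)
  · exact Or.inl hx

end ComplexMeasures

/-! ### Smooth cutoff functions -/

section Cutoff

variable {N : ℕ} {X : Type*} [TopologicalSpace X] [T2Space X]
  [ChartedSpace (EuclideanSpace ℝ (Fin N)) X]

/-- Smooth cutoff functions in the domain of a chart. -/
theorem exists_contMDiff_cutoff {e : OpenPartialHomeomorph X (EuclideanSpace ℝ (Fin N))}
    (he : e ∈ IsManifold.maximalAtlas (𝓡 N) ∞ X) {K V : Set X} (hK : IsCompact K)
    (hV : IsOpen V) (hKV : K ⊆ V) (hVe : V ⊆ e.source) :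
    ∃ χ : X → ℝ, ContMDiff (𝓡 N) 𝓘(ℝ, ℝ) ∞ χ ∧ HasCompactSupport χ ∧ tsupport χ ⊆ V ∧
      (∀ᶠ x in nhdsSet K, χ x = 1) ∧ ∀ x, χ x ∈ Set.Icc (0 : ℝ) 1 := by
  -- No countability is assumed on `X`, so the bump is built in Euclidean space and pulled back by
  -- the chart.
  have hK' : IsCompact (e '' K) := hK.image_of_continuousOn (e.continuousOn.mono (hKV.trans hVe))
  have hV' : IsOpen (e '' V) := e.isOpen_image_of_subset_source hV hVe
  obtain ⟨L, hL, hKL, hLV⟩ := exists_compact_between hK' hV' (Set.image_mono hKV)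
  obtain ⟨f, hf1, hf0, hf⟩ := exists_contMDiffMap_one_nhds_of_subset_interior
    (𝓡 N) (n := ⊤) hK'.isClosed hKL
  set L' : Set X := e.symm '' L with hL'
  have hLt : L ⊆ e.target := hLV.trans (by
    rintro _ ⟨x, hx, rfl⟩; exact e.map_source (hVe hx))
  -- Compact sets in the Hausdorff space `X` are closed, so the extension by zero has its closed
  -- support inside the chart domain and is smooth on all of `X`.
  have hL'c : IsCompact L' := hL.image_of_continuousOn (e.continuousOn_symm.mono hLt)
  have hL'V : L' ⊆ V := by
    rintro _ ⟨y, hy, rfl⟩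
    obtain ⟨x, hx, rfl⟩ := hLV hy
    rwa [e.left_inv (hVe hx)]
  classical
  let χ : X → ℝ := e.source.indicator fun x => f (e x)
  have hsupp : Function.support χ ⊆ L' := by
    intro x hx
    have hxs : x ∈ e.source := by
      by_contra h
      exact hx (Set.indicator_of_notMem h _)
    rw [Function.mem_support, show χ x = f (e x) from Set.indicator_of_mem hxs _] at hx
    refine ⟨e x, ?_, e.left_inv hxs⟩
    by_contra h
    exact hx (hf0 _ h)
  have htsupp : tsupport χ ⊆ L' := closure_minimal hsupp hL'c.isClosed
  refine ⟨χ, ?_, hL'c.of_isClosed_subset (isClosed_tsupport _) htsupp, htsupp.trans hL'V, ?_, ?_⟩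
  · refine contMDiff_of_tsupport fun x hx => ?_
    have hxs : x ∈ e.source := hVe (hL'V (htsupp hx))
    have h1 : ContMDiffAt (𝓡 N) 𝓘(ℝ, ℝ) ∞ (f ∘ e) x :=
      f.contMDiff.contMDiffAt.comp x
        ((contMDiffOn_of_mem_maximalAtlas he).contMDiffAt (e.open_source.mem_nhds hxs))
    refine h1.congr_of_eventuallyEq ?_
    filter_upwards [e.open_source.mem_nhds hxs] with y hy
    exact Set.indicator_of_mem hy _
  · rw [eventually_nhdsSet_iff_forall] at hf1 ⊢
    intro x hx
    have hxs : x ∈ e.source := hVe (hKV hx)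
    have h1 := (e.continuousAt hxs).eventually (hf1 _ (Set.mem_image_of_mem e hx))
    filter_upwards [e.open_source.mem_nhds hxs, h1] with y hy hy1
    exact (Set.indicator_of_mem hy _).trans hy1
  · intro x
    by_cases hxs : x ∈ e.source
    · simpa only [χ, Set.indicator_of_mem hxs] using hf (e x)
    · simp only [χ, Set.indicator_of_notMem hxs]; simp

omit [T2Space X] in
theorem contMDiff_smul_of_tsupport {F : Type*} [NormedAddCommGroup F] [NormedSpace ℝ F]
    {χ : X → ℝ} {g : X → F} {V : Set X} (hχ : ContMDiff (𝓡 N) 𝓘(ℝ, ℝ) ∞ χ) (hV : IsOpen V)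
    (hχV : tsupport χ ⊆ V) (hg : ContMDiffOn (𝓡 N) 𝓘(ℝ, F) ∞ g V) :
    ContMDiff (𝓡 N) 𝓘(ℝ, F) ∞ fun x => χ x • g x := by
  refine contMDiff_of_tsupport fun x hx => ?_
  have hx' : x ∈ tsupport χ := closure_mono (Function.support_smul_subset_left χ g) hx
  exact hχ.contMDiffAt.smul (hg.contMDiffAt (hV.mem_nhds (hχV hx')))

end Cutoff

end CRGeometry

namespace CRGeometry

/-! ### Derivatives along real and complex vector fields -/

section FieldDeriv

variable {N : ℕ} {X : Type*} [TopologicalSpace X] [ChartedSpace (EuclideanSpace ℝ (Fin N)) X]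
  [IsManifold (𝓡 N) ∞ X] {F : Type*} [NormedAddCommGroup F] [NormedSpace ℝ F]

/-- The derivative of `f` at `x` along a tangent vector, as a linear map to the value space. -/
noncomputable abbrev tangentDeriv (f : X → F) (x : X) : TangentSpace (𝓡 N) x →L[ℝ] F :=
  mfderiv (𝓡 N) 𝓘(ℝ, F) f x

/-- Apply the tangent map of `f` to the section `V` and take the fibre component. -/
theorem contMDiffOn_tangentDeriv {f : X → F} {U : Set X} (hU : IsOpen U)
    (hf : ContMDiffOn (𝓡 N) 𝓘(ℝ, F) ∞ f U) {V : ∀ x : X, TangentSpace (𝓡 N) x}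
    (hV : ContMDiffOn (𝓡 N) (𝓡 N).tangent ∞ (fun x => (⟨x, V x⟩ : TangentBundle (𝓡 N) X)) U) :
    ContMDiffOn (𝓡 N) 𝓘(ℝ, F) ∞ (fun x => tangentDeriv f x (V x)) U := by
  have : IsManifold (𝓡 N) 1 X := IsManifold.of_le (n := ∞) (by norm_num)
  have h1 := hf.contMDiffOn_tangentMapWithin (m := ∞) (by simp) hU.uniqueMDiffOn
  have h2 := (contMDiff_snd_tangentBundle_modelSpace (n := ∞) F 𝓘(ℝ, F)).comp_contMDiffOn
    (h1.comp hV fun x hx => hx)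
  refine h2.congr fun x hx => ?_
  simp only [Function.comp, tangentMapWithin, mfderivWithin_of_isOpen hU hx]
  rfl

omit [IsManifold (𝓡 N) ∞ X] in
theorem contMDiffOn_complex_mul {f g : X → ℂ} {U : Set X}
    (hf : ContMDiffOn (𝓡 N) 𝓘(ℝ, ℂ) ∞ f U) (hg : ContMDiffOn (𝓡 N) 𝓘(ℝ, ℂ) ∞ g U) :
    ContMDiffOn (𝓡 N) 𝓘(ℝ, ℂ) ∞ (fun x => f x * g x) U :=
  (contDiff_mul (𝕜 := ℝ) (𝔸 := ℂ)).contMDiff.comp_contMDiffOn (hf.prodMk_space hg)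

theorem contMDiffOn_fieldDeriv {f : X → ℂ} {U : Set X} (hU : IsOpen U)
    (hf : ContMDiffOn (𝓡 N) 𝓘(ℝ, ℂ) ∞ f U) {Z : ∀ x : X, ComplexTangentSpace N x}
    (hZ : IsSmoothFieldOn Z U) :
    ContMDiffOn (𝓡 N) 𝓘(ℝ, ℂ) ∞ (fieldDeriv Z f) U := by
  have h1 := contMDiffOn_tangentDeriv hU hf hZ.1
  have h2 := contMDiffOn_tangentDeriv hU hf hZ.2
  exact h1.add ((ContinuousLinearMap.mul ℝ ℂ Complex.I).contMDiff.comp_contMDiffOn h2)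

omit [IsManifold (𝓡 N) ∞ X] in
theorem fieldDeriv_eq (Z : ∀ x : X, ComplexTangentSpace N x) (f : X → ℂ) (x : X) :
    fieldDeriv Z f x = tangentDeriv f x (rePart N x (Z x)) +
      Complex.I * tangentDeriv f x (imPart N x (Z x)) := rfl

omit [IsManifold (𝓡 N) ∞ X] in
theorem fieldDeriv_mul {Z : ∀ x : X, ComplexTangentSpace N x} {f g : X → ℂ} {x : X}
    (hf : MDifferentiableAt (𝓡 N) 𝓘(ℝ, ℂ) f x) (hg : MDifferentiableAt (𝓡 N) 𝓘(ℝ, ℂ) g x) :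
    fieldDeriv Z (fun y => f y * g y) x = f x * fieldDeriv Z g x + g x * fieldDeriv Z f x := by
  have h : ∀ v : TangentSpace (𝓡 N) x, tangentDeriv (fun y => f y * g y) x v =
      f x * tangentDeriv g x v + g x * tangentDeriv f x v := by
    intro v
    have := (hf.hasMFDerivAt.mul hg.hasMFDerivAt).mfderiv
    have h2 := congrArg (fun L => L v) this
    exact h2
  rw [fieldDeriv_eq, fieldDeriv_eq, fieldDeriv_eq, h, h]
  ring

omit [IsManifold (𝓡 N) ∞ X] in
theorem tangentDeriv_comp {F' : Type*} [NormedAddCommGroup F'] [NormedSpace ℝ F'] {G : F → F'}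
    {r : X → F} {x : X} (hG : DifferentiableAt ℝ G (r x))
    (hr : MDifferentiableAt (𝓡 N) 𝓘(ℝ, F) r x) (v : TangentSpace (𝓡 N) x) :
    tangentDeriv (fun y => G (r y)) x v = fderiv ℝ G (r x) (tangentDeriv r x v) := by
  have h := mfderiv_comp x hG.mdifferentiableAt hr
  have h2 := congrArg (fun L => L v) h
  rw [mfderiv_eq_fderiv] at h2
  exact h2

omit [IsManifold (𝓡 N) ∞ X] in
/-- The derivative of a vector valued function along a complex tangent vector, paired with
a real linear map into `ℂ`. -/
theorem fieldDeriv_comp {Z : ∀ x : X, ComplexTangentSpace N x} {G : F → ℂ} {r : X → F} {x : X}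
    (hG : DifferentiableAt ℝ G (r x)) (hr : MDifferentiableAt (𝓡 N) 𝓘(ℝ, F) r x) :
    fieldDeriv Z (fun y => G (r y)) x =
      fderiv ℝ G (r x) (tangentDeriv r x (rePart N x (Z x))) +
        Complex.I * fderiv ℝ G (r x) (tangentDeriv r x (imPart N x (Z x))) := by
  rw [fieldDeriv_eq, tangentDeriv_comp hG hr, tangentDeriv_comp hG hr]

end FieldDeriv

end CRGeometry

namespace CRGeometry

/-! ### Integration by parts in Euclidean space -/

section EuclideanDivergence

variable {N : ℕ}

local notation "𝔼" => EuclideanSpace ℝ (Fin N)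

theorem continuous_mul_of_tsupport {Y : Type*} [TopologicalSpace Y] {u w : Y → ℂ} {T : Set Y}
    (hT : IsOpen T) (hu : Continuous u) (huT : tsupport u ⊆ T) (hw : ContinuousOn w T) :
    Continuous fun y => u y * w y := by
  refine continuous_of_tsupport fun y hy => ?_
  have hy' : y ∈ T := huT (closure_mono (Function.support_mul_subset_left u w) hy)
  exact hu.continuousAt.mul (hw.continuousAt (hT.mem_nhds hy'))

/-- The divergence theorem for compactly supported vector fields. -/
theorem integral_sum_mul_fderiv_eq_neg {T : Set 𝔼} (hT : IsOpen T) {V : Fin N → 𝔼 → ℂ}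
    (hV : ∀ k, ContDiff ℝ ∞ (V k)) (hVc : ∀ k, HasCompactSupport (V k))
    (hVT : ∀ k, tsupport (V k) ⊆ T) {F : 𝔼 → ℂ} (hF : ContDiffOn ℝ ∞ F T) (v : Fin N → 𝔼) :
    ∫ y, ∑ k, V k y * fderiv ℝ F y (v k) = -∫ y, (∑ k, fderiv ℝ (V k) y (v k)) * F y := by
  have hdF : ∀ k, ContinuousOn (fun y => fderiv ℝ F y (v k)) T := fun k =>
    (hF.continuousOn_fderiv_of_isOpen hT (by simp)).clm_apply continuousOn_const
  have hdV : ∀ k, Continuous fun y => fderiv ℝ (V k) y (v k) := fun k =>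
    ((hV k).continuous_fderiv (by simp)).clm_apply continuous_const
  have hdVs : ∀ k, tsupport (fun y => fderiv ℝ (V k) y (v k)) ⊆ tsupport (V k) := fun k =>
    tsupport_fderiv_apply_subset ℝ (v k)
  have h1 : ∀ k, Integrable fun y => V k y * fderiv ℝ F y (v k) := fun k =>
    (continuous_mul_of_tsupport hT (hV k).continuous (hVT k) (hdF k)).integrable_of_hasCompactSupport
      (hVc k).mul_right
  have h2 : ∀ k, Integrable fun y => fderiv ℝ (V k) y (v k) * F y := fun k =>
    (continuous_mul_of_tsupport hT (hdV k) ((hdVs k).trans (hVT k))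
      hF.continuousOn).integrable_of_hasCompactSupport
      (HasCompactSupport.mul_right ((hVc k).of_isClosed_subset (isClosed_tsupport _) (hdVs k)))
  have h3 : ∀ k, Integrable fun y => V k y * F y := fun k =>
    (continuous_mul_of_tsupport hT (hV k).continuous (hVT k)
      hF.continuousOn).integrable_of_hasCompactSupport (hVc k).mul_right
  rw [integral_finsetSum _ fun k _ => h1 k]
  simp_rw [Finset.sum_mul]
  rw [integral_finsetSum _ fun k _ => h2 k, ← Finset.sum_neg_distrib]
  refine Finset.sum_congr rfl fun k _ => ?_
  refine integral_mul_fderiv_eq_neg_fderiv_mul_of_integrable (h2 k) (h1 k) (h3 k)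
    (fun y _ => (hV k).differentiable (by simp) y) fun y hy => ?_
  exact (hF.contDiffAt (hT.mem_nhds (hVT k hy))).differentiableAt (by simp)

end EuclideanDivergence

/-! ### Smooth positive measures and existence of formal adjoints -/

section SmoothMeasure

variable {N : ℕ} {X : Type*} [TopologicalSpace X]
  [ChartedSpace (EuclideanSpace ℝ (Fin N)) X] [IsManifold (𝓡 N) ∞ X]
  [MeasurableSpace X] [BorelSpace X] {μ : Measure X}

local notation "𝔼" => EuclideanSpace ℝ (Fin N)

omit [ChartedSpace 𝔼 X] [IsManifold (𝓡 N) ∞ X] in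
theorem aemeasurable_chart (e : OpenPartialHomeomorph X 𝔼) :
    AEMeasurable e (μ.restrict e.source) :=
  e.continuousOn.aemeasurable e.open_source.measurableSet

omit [ChartedSpace 𝔼 X] [IsManifold (𝓡 N) ∞ X] in
theorem measure_lt_top_of_isCompact_subset_source {e : OpenPartialHomeomorph X 𝔼} {ρ : 𝔼 → ℝ}
    (hρ : ContDiffOn ℝ ∞ ρ e.target)
    (hμ : (μ.restrict e.source).map e =
      (volume.restrict e.target).withDensity fun y => ENNReal.ofReal (ρ y))
    {K : Set X} (hK : IsCompact K) (hKe : K ⊆ e.source) : μ K < ⊤ := by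
  have hK' : IsCompact (e '' K) := hK.image_of_continuousOn (e.continuousOn.mono hKe)
  have hKt : e '' K ⊆ e.target := by
    rintro _ ⟨x, hx, rfl⟩; exact e.map_source (hKe hx)
  have h1 : μ K ≤ (μ.restrict e.source).map e (e '' K) := by
    rw [Measure.map_apply_of_aemeasurable (aemeasurable_chart e) hK'.measurableSet]
    calc μ K ≤ μ (e ⁻¹' (e '' K) ∩ e.source) :=
          measure_mono fun x hx => ⟨Set.mem_image_of_mem e hx, hKe hx⟩
      _ ≤ _ := Measure.le_restrict_apply _ _
  refine h1.trans_lt ?_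
  obtain ⟨C, hC⟩ := hK'.exists_bound_of_continuousOn (hρ.continuousOn.mono hKt)
  rw [hμ, withDensity_apply _ hK'.measurableSet]
  calc ∫⁻ y in e '' K, ENNReal.ofReal (ρ y) ∂(volume.restrict e.target)
      ≤ ∫⁻ _ in e '' K, ENNReal.ofReal C ∂(volume.restrict e.target) := by
        refine setLIntegral_mono' hK'.measurableSet fun y hy => ?_
        exact ENNReal.ofReal_le_ofReal ((le_abs_self _).trans (hC y hy))
    _ = ENNReal.ofReal C * volume.restrict e.target (e '' K) := by
        rw [setLIntegral_const]
    _ < ⊤ := ENNReal.mul_lt_top ENNReal.ofReal_lt_top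
        ((Measure.restrict_apply_le _ _).trans_lt hK'.measure_lt_top)

/-- Each point has a compact neighbourhood inside a chart, where the density is bounded. -/
theorem IsSmoothPositiveMeasure.isFiniteMeasureOnCompacts (hμ : IsSmoothPositiveMeasure N μ) :
    IsFiniteMeasureOnCompacts μ := by
  have : LocallyCompactSpace X := ChartedSpace.locallyCompactSpace 𝔼 X
  have h : IsLocallyFiniteMeasure μ := by
    refine ⟨fun x => ?_⟩
    obtain ⟨ρ, hρ, -, hρμ⟩ := hμ (chartAt 𝔼 x) (IsManifold.chart_mem_maximalAtlas x)
    obtain ⟨K, hK, hxK, hKe⟩ := exists_compact_subset (chartAt 𝔼 x).open_source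
      (mem_chart_source 𝔼 x)
    exact ⟨K, mem_interior_iff_mem_nhds.1 hxK,
      measure_lt_top_of_isCompact_subset_source hρ hρμ hK hKe⟩
  infer_instance

omit [ChartedSpace 𝔼 X] [IsManifold (𝓡 N) ∞ X] in
/-- Integration in a chart. -/
theorem integral_eq_setIntegral_chart {e : OpenPartialHomeomorph X 𝔼} {ρ : 𝔼 → ℝ}
    (hρ : ContDiffOn ℝ ∞ ρ e.target) (hρ0 : ∀ y ∈ e.target, 0 < ρ y)
    (hμ : (μ.restrict e.source).map e =
      (volume.restrict e.target).withDensity fun y => ENNReal.ofReal (ρ y))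
    {h : X → ℂ} (hh : ContinuousOn h e.source) (h0 : ∀ x ∉ e.source, h x = 0) :
    ∫ x, h x ∂μ = ∫ y in e.target, ρ y • h (e.symm y) := by
  have htm : MeasurableSet e.target := e.open_target.measurableSet
  have hm : AEMeasurable (fun y => ENNReal.ofReal (ρ y)) (volume.restrict e.target) :=
    (hρ.continuousOn.aemeasurable htm).ennreal_ofReal
  rw [← setIntegral_eq_integral_of_forall_compl_eq_zero h0]
  have h1 : ∫ x in e.source, h x ∂μ = ∫ x in e.source, h (e.symm (e x)) ∂μ := by
    refine setIntegral_congr_fun e.open_source.measurableSet fun x hx => ?_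
    simp only [e.left_inv hx]
  have hc : ContinuousOn (fun y => h (e.symm y)) e.target :=
    hh.comp e.continuousOn_symm fun y hy => e.map_target hy
  rw [h1, ← integral_map (f := fun y => h (e.symm y)) (aemeasurable_chart e), hμ,
    integral_withDensity_eq_integral_toReal_smul₀ hm]
  · refine setIntegral_congr_fun htm fun y hy => ?_
    simp only [ENNReal.toReal_ofReal (hρ0 y hy).le]
  · exact Filter.Eventually.of_forall fun _ => ENNReal.ofReal_lt_top
  · rw [hμ]
    exact (hc.aestronglyMeasurable htm).mono_ac (withDensity_absolutelyContinuous _ _)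

omit [IsManifold (𝓡 N) ∞ X] [MeasurableSpace X] [BorelSpace X] in
-- Chain rule for `f = (f ∘ e.symm) ∘ e`, valid near `x`.
theorem tangentDeriv_eq_fderiv_chart {e : OpenPartialHomeomorph X 𝔼}
    (he : e ∈ IsManifold.maximalAtlas (𝓡 N) ∞ X) {F : Type*} [NormedAddCommGroup F]
    [NormedSpace ℝ F] {f : X → F} {U : Set X} (hU : IsOpen U) (hUe : U ⊆ e.source)
    (hf : ContMDiffOn (𝓡 N) 𝓘(ℝ, F) ∞ f U) {x : X} (hx : x ∈ U) (v : TangentSpace (𝓡 N) x) :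
    tangentDeriv f x v =
      fderiv ℝ (fun y => f (e.symm y)) (e x) (tangentDeriv (F := 𝔼) e x v) := by
  have hxe := hUe hx
  have h1 : MDifferentiableAt (𝓡 N) 𝓘(ℝ, 𝔼) e x :=
    ((contMDiffOn_of_mem_maximalAtlas he).contMDiffAt
      (e.open_source.mem_nhds hxe)).mdifferentiableAt (by simp)
  have h2 : ContMDiffAt (𝓡 N) 𝓘(ℝ, F) ∞ (fun y => f (e.symm y)) (e x) := by
    refine ContMDiffAt.comp (e x) (g := f) (f := e.symm) (I' := 𝓡 N) ?_ ?_
    · rw [e.left_inv hxe]; exact hf.contMDiffAt (hU.mem_nhds hx)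
    · exact (contMDiffOn_symm_of_mem_maximalAtlas he).contMDiffAt
        (e.open_target.mem_nhds (e.map_source hxe))
  have h3 : DifferentiableAt ℝ (fun y => f (e.symm y)) (e x) :=
    (contMDiffAt_iff_contDiffAt.1 h2).differentiableAt (by simp)
  rw [← tangentDeriv_comp h3 h1]
  have h4 : f =ᶠ[nhds x] fun y => f (e.symm (e y)) := by
    filter_upwards [e.open_source.mem_nhds hxe] with y hy
    rw [e.left_inv hy]
  have h5 := h4.mfderiv_eq (I := 𝓡 N) (I' := 𝓘(ℝ, F))
  exact congrArg (fun L => L v) h5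

omit [IsManifold (𝓡 N) ∞ X] [MeasurableSpace X] [BorelSpace X] in
theorem contDiffOn_comp_chart_symm {e : OpenPartialHomeomorph X 𝔼}
    (he : e ∈ IsManifold.maximalAtlas (𝓡 N) ∞ X) {F : Type*} [NormedAddCommGroup F]
    [NormedSpace ℝ F] {f : X → F} (hf : ContMDiffOn (𝓡 N) 𝓘(ℝ, F) ∞ f e.source) :
    ContDiffOn ℝ ∞ (fun y => f (e.symm y)) e.target :=
  contMDiffOn_iff_contDiffOn.1 (hf.comp (contMDiffOn_symm_of_mem_maximalAtlas he)
    fun _ hy => e.map_target hy)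

/-- If Z has coordinate vector a and the density is ρ, the divergence theorem for the field ρφa
gives Z†φ = −ρ⁻¹ div(ρφa). Since φ is supported in a single chart, this extends by zero. -/
theorem exists_isFormalAdjointValue (hμ : IsSmoothPositiveMeasure N μ)
    {e : OpenPartialHomeomorph X 𝔼} (he : e ∈ IsManifold.maximalAtlas (𝓡 N) ∞ X)
    {Z : ∀ x : X, ComplexTangentSpace N x} (hZ : IsSmoothFieldOn Z Set.univ)
    {φ : X → ℂ} (hφ : IsTestFunction N φ) (hφe : tsupport φ ⊆ e.source) :
    ∃ ψ : X → ℂ, IsFormalAdjointValue μ Z φ ψ := by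
  obtain ⟨ρ, hρ, hρ0, hρμ⟩ := hμ e he
  have hZ1 := (contMDiffOn_tangentDeriv (F := 𝔼) e.open_source
    (contMDiffOn_of_mem_maximalAtlas he) (hZ.1.mono (Set.subset_univ _)))
  have hZ2 := (contMDiffOn_tangentDeriv (F := 𝔼) e.open_source
    (contMDiffOn_of_mem_maximalAtlas he) (hZ.2.mono (Set.subset_univ _)))
  have hA := contDiffOn_comp_chart_symm he hZ1
  have hB := contDiffOn_comp_chart_symm he hZ2
  have hΦ := contDiffOn_comp_chart_symm he (hφ.1.contMDiffOn (s := e.source))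
  set A : X → 𝔼 := fun x => tangentDeriv (F := 𝔼) e x (rePart N x (Z x))
  set B : X → 𝔼 := fun x => tangentDeriv (F := 𝔼) e x (imPart N x (Z x))
  -- The coordinate field ρφa, extended by zero; smooth because the image of `tsupport φ` is compact
  -- in the chart target.
  let V : Fin N → 𝔼 → ℂ := fun k => e.target.indicator fun y =>
    ρ y • (φ (e.symm y) * ((A (e.symm y) k : ℂ) + Complex.I * (B (e.symm y) k : ℂ)))
  let v : Fin N → 𝔼 := fun k => EuclideanSpace.single k 1
  set K : Set 𝔼 := e '' tsupport φ with hKdef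
  have hK : IsCompact K := hφ.2.isCompact.image_of_continuousOn (e.continuousOn.mono hφe)
  have hKt : K ⊆ e.target := by
    rintro _ ⟨x, hx, rfl⟩; exact e.map_source (hφe hx)
  have hVs : ∀ k, tsupport (V k) ⊆ K := by
    refine fun k => closure_minimal (fun y hy => ?_) hK.isClosed
    have hyt : y ∈ e.target := by
      by_contra h
      exact hy (Set.indicator_of_notMem h _)
    refine ⟨e.symm y, ?_, e.right_inv hyt⟩
    by_contra h
    refine hy ?_
    simp only [V, Set.indicator_of_mem hyt, image_eq_zero_of_notMem_tsupport h, zero_mul, smul_zero]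
  have hVc : ∀ k, HasCompactSupport (V k) := fun k =>
    hK.of_isClosed_subset (isClosed_tsupport _) (hVs k)
  have hV : ∀ k, ContDiff ℝ ∞ (V k) := by
    intro k
    have hAk : ContDiffOn ℝ ∞ (fun y => (A (e.symm y) k : ℂ)) e.target :=
      (Complex.ofRealCLM.comp (EuclideanSpace.proj k : 𝔼 →L[ℝ] ℝ)).contDiff.comp_contDiffOn hA
    have hBk : ContDiffOn ℝ ∞ (fun y => (B (e.symm y) k : ℂ)) e.target :=
      (Complex.ofRealCLM.comp (EuclideanSpace.proj k : 𝔼 →L[ℝ] ℝ)).contDiff.comp_contDiffOn hB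
    have h1 := hρ.smul (hΦ.mul (hAk.add (contDiffOn_const (c := Complex.I).mul hBk)))
    refine contMDiff_iff_contDiff.1 (contMDiff_of_tsupport fun y hy => ?_)
    have hyt : y ∈ e.target := hKt (hVs k hy)
    refine contMDiffAt_iff_contDiffAt.2
      ((h1.contDiffAt (e.open_target.mem_nhds hyt)).congr_of_eventuallyEq ?_)
    filter_upwards [e.open_target.mem_nhds hyt] with z hz
    exact Set.indicator_of_mem hz _
  let D : 𝔼 → ℂ := fun y => ∑ k, fderiv ℝ (V k) y (v k)
  have hD : ContDiff ℝ ∞ D := ContDiff.sum fun k _ =>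
    ((hV k).fderiv_right (m := ∞) (by simp)).clm_apply contDiff_const
  have hD0 : ∀ y ∉ K, D y = 0 := by
    refine fun y hy => Finset.sum_eq_zero fun k _ => ?_
    have h1 : y ∉ tsupport (fun z => fderiv ℝ (V k) z (v k)) := fun h =>
      hy (hVs k (tsupport_fderiv_apply_subset ℝ (v k) h))
    exact image_eq_zero_of_notMem_tsupport (f := fun z => fderiv ℝ (V k) z (v k)) h1
  let ψ : X → ℂ := e.source.indicator fun x => -((ρ (e x))⁻¹ • D (e x))
  have hψs : tsupport ψ ⊆ tsupport φ := by
    refine closure_minimal (fun x hx => ?_) (isClosed_tsupport _)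
    have hxs : x ∈ e.source := by
      by_contra h
      exact hx (Set.indicator_of_notMem h _)
    by_contra h
    refine hx ?_
    have : e x ∉ K := by
      rintro ⟨z, hz, hzx⟩
      rw [e.injOn (hφe hz) hxs hzx] at hz
      exact h hz
    simp only [ψ, Set.indicator_of_mem hxs, hD0 _ this, smul_zero, neg_zero]
  have hψ : ContMDiff (𝓡 N) 𝓘(ℝ, ℂ) ∞ ψ := by
    have h1 : ContDiffOn ℝ ∞ (fun y => -((ρ y)⁻¹ • D y)) e.target :=
      ((hρ.inv fun y hy => (hρ0 y hy).ne').smul hD.contDiffOn).neg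
    have h2 := h1.contMDiffOn.comp (contMDiffOn_of_mem_maximalAtlas he) fun x hx => e.map_source hx
    refine contMDiff_of_tsupport fun x hx => ?_
    have hxs : x ∈ e.source := hφe (hψs hx)
    refine (h2.contMDiffAt (e.open_source.mem_nhds hxs)).congr_of_eventuallyEq ?_
    filter_upwards [e.open_source.mem_nhds hxs] with z hz
    exact Set.indicator_of_mem hz _
  refine ⟨ψ, ⟨hψ, hφ.2.of_isClosed_subset (isClosed_tsupport _) hψs⟩, fun f hf => ?_⟩
  have hF := contDiffOn_comp_chart_symm he (hf.contMDiffOn (s := e.source))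
  have hdf := contMDiffOn_fieldDeriv isOpen_univ hf.contMDiffOn hZ
  rw [contMDiffOn_univ] at hdf
  rw [integral_eq_setIntegral_chart (h := fun x => f x * ψ x) hρ hρ0 hρμ (hf.continuous.mul hψ.continuous).continuousOn
    (fun x hx => by simp only [ψ, Set.indicator_of_notMem hx, mul_zero]),
    integral_eq_setIntegral_chart (h := fun x => φ x * fieldDeriv Z f x) hρ hρ0 hρμ (hφ.1.continuous.mul hdf.continuous).continuousOn
    (fun x hx => by
      simp only [image_eq_zero_of_notMem_tsupport (fun h => hx (hφe h)), zero_mul])]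
  have htm : MeasurableSet e.target := e.open_target.measurableSet
  have hdiv := integral_sum_mul_fderiv_eq_neg e.open_target hV hVc (fun k => (hVs k).trans hKt) hF v
  rw [← setIntegral_eq_integral_of_forall_compl_eq_zero (s := e.target)
    (f := fun y => (∑ k, fderiv ℝ (V k) y (v k)) * f (e.symm y)),
    ← setIntegral_eq_integral_of_forall_compl_eq_zero (s := e.target), ← integral_neg] at hdiv
  · refine Eq.trans ?_ (hdiv.symm.trans ?_)
    · refine setIntegral_congr_fun htm fun y hy => ?_
      have h1 : (ρ y : ℂ) ≠ 0 := by exact_mod_cast (hρ0 y hy).ne'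
      simp only [ψ, Set.indicator_of_mem (e.map_target hy), e.right_inv hy, D]
      simp only [Complex.real_smul, Complex.ofReal_inv]
      field_simp
    -- Expanding the coordinate vectors of the real and imaginary parts of `Z` in the standard basis
    -- turns `Z f` into a combination of partial derivatives.
    · refine setIntegral_congr_fun htm fun y hy => ?_
      have hye := e.map_target hy
      have h1 : ∀ w : TangentSpace (𝓡 N) (e.symm y), tangentDeriv f (e.symm y) w =
          ∑ k, (tangentDeriv (F := 𝔼) e (e.symm y) w k : ℂ) *
            fderiv ℝ (fun y => f (e.symm y)) y (v k) := by
        intro w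
        rw [tangentDeriv_eq_fderiv_chart he e.open_source subset_rfl hf.contMDiffOn hye,
          e.right_inv hy]
        set u : 𝔼 := tangentDeriv (F := 𝔼) e (e.symm y) w
        have hu : u = ∑ k, u k • v k := by
          simpa using ((EuclideanSpace.basisFun (Fin N) ℝ).sum_repr u).symm
        conv_lhs => rw [hu]
        simp only [map_sum, map_smul, Complex.real_smul]
      simp only [V, Set.indicator_of_mem hy, fieldDeriv_eq, h1, A, B,
        Complex.real_smul, Finset.mul_sum, ← Finset.sum_add_distrib]
      refine Finset.sum_congr rfl fun k _ => ?_
      ring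
  · intro y hy
    refine Finset.sum_eq_zero fun k _ => ?_
    simp only [V, Set.indicator_of_notMem hy, zero_mul]
  · intro y hy
    have : D y = 0 := hD0 y fun h => hy (hKt h)
    simp only [D] at this
    rw [this, zero_mul]

end SmoothMeasure

end CRGeometry

namespace CRGeometry

/-! ### Concentrating the CR condition on a zero set -/

section LimitArgument

variable {N : ℕ} {X : Type*} [TopologicalSpace X] [ChartedSpace (EuclideanSpace ℝ (Fin N)) X]
  [IsManifold (𝓡 N) ∞ X]

omit [IsManifold (𝓡 N) ∞ X] in
theorem IsTestFunction.mul_right {φ g : X → ℂ} (hφ : IsTestFunction N φ)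
    (hg : ContMDiff (𝓡 N) 𝓘(ℝ, ℂ) ∞ g) : IsTestFunction N fun x => φ x * g x := by
  refine ⟨?_, hφ.2.mul_right⟩
  rw [← contMDiffOn_univ]
  exact contMDiffOn_complex_mul hφ.1.contMDiffOn hg.contMDiffOn

theorem contMDiff_fieldDeriv {f : X → ℂ} (hf : ContMDiff (𝓡 N) 𝓘(ℝ, ℂ) ∞ f)
    {Z : ∀ x : X, ComplexTangentSpace N x} (hZ : IsSmoothFieldOn Z Set.univ) :
    ContMDiff (𝓡 N) 𝓘(ℝ, ℂ) ∞ (fieldDeriv Z f) := by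
  rw [← contMDiffOn_univ]
  exact contMDiffOn_fieldDeriv isOpen_univ hf.contMDiffOn hZ

variable [MeasurableSpace X] [BorelSpace X] {μ : Measure X}

/-- Test the identity for `ψ` against `f * g` and expand by the product rule. New test functions are
thus obtained without recomputing adjoints. -/
theorem IsFormalAdjointValue.mul_right [IsFiniteMeasureOnCompacts μ]
    {Z : ∀ x : X, ComplexTangentSpace N x} (hZ : IsSmoothFieldOn Z Set.univ) {φ ψ g : X → ℂ}
    (hφ : IsTestFunction N φ) (h : IsFormalAdjointValue μ Z φ ψ)
    (hg : ContMDiff (𝓡 N) 𝓘(ℝ, ℂ) ∞ g) :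
    IsFormalAdjointValue μ Z (fun x => φ x * g x)
      (fun x => ψ x * g x - φ x * fieldDeriv Z g x) := by
  have hZg := contMDiff_fieldDeriv hg hZ
  have h1 := h.1.mul_right hg
  have h2 := hφ.mul_right hZg
  refine ⟨⟨h1.1.sub h2.1, h1.2.sub h2.2⟩, fun f hf => ?_⟩
  have hZf := contMDiff_fieldDeriv hf hZ
  have hfg : ContMDiff (𝓡 N) 𝓘(ℝ, ℂ) ∞ fun x => f x * g x := by
    rw [← contMDiffOn_univ]
    exact contMDiffOn_complex_mul hf.contMDiffOn hg.contMDiffOn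
  have hZfg := contMDiff_fieldDeriv hfg hZ
  have hint : ∀ {u w : X → ℂ}, IsTestFunction N u → ContMDiff (𝓡 N) 𝓘(ℝ, ℂ) ∞ w →
      Integrable (fun x => u x * w x) μ := fun hu hw =>
    (hu.1.continuous.mul hw.continuous).integrable_of_hasCompactSupport hu.2.mul_right
  calc ∫ x, f x * (ψ x * g x - φ x * fieldDeriv Z g x) ∂μ
      = ∫ x, (ψ x * (f x * g x) - (φ x * fieldDeriv Z g x) * f x) ∂μ := by
        congr 1; ext x; ring
    _ = ∫ x, ψ x * (f x * g x) ∂μ - ∫ x, (φ x * fieldDeriv Z g x) * f x ∂μ :=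
        integral_sub (hint h.1 hfg) (hint h2 hf)
    _ = ∫ x, φ x * fieldDeriv Z (fun x => f x * g x) x ∂μ -
          ∫ x, (φ x * fieldDeriv Z g x) * f x ∂μ := by
        rw [← h.2 _ hfg]; congr 2; ext x; ring
    _ = ∫ x, (φ x * fieldDeriv Z (fun x => f x * g x) x - (φ x * fieldDeriv Z g x) * f x) ∂μ :=
        (integral_sub (hint hφ hZfg) (hint h2 hf)).symm
    _ = ∫ x, φ x * g x * fieldDeriv Z f x ∂μ := by
        congr 1; ext x
        rw [fieldDeriv_mul (hf.mdifferentiable (by simp) x) (hg.mdifferentiable (by simp) x)]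
        ring

variable {F : Type*} [NormedAddCommGroup F] [NormedSpace ℝ F] [FiniteDimensional ℝ F]

/-- A compactly supported smooth function that agrees with a linear form near `0`. -/
theorem exists_contDiff_hasCompactSupport_eventuallyEq (ℓ : F →L[ℝ] ℂ) :
    ∃ G : F → ℂ, ContDiff ℝ ∞ G ∧ HasCompactSupport G ∧ G =ᶠ[nhds 0] ℓ := by
  let θ : ContDiffBump (0 : F) := ⟨1, 2, by norm_num, by norm_num⟩
  refine ⟨fun v => θ v • ℓ v, θ.contDiff.smul ℓ.contDiff, θ.hasCompactSupport.smul_right, ?_⟩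
  filter_upwards [θ.eventuallyEq_one] with v hv
  simp [hv]

/-- Concentrating the derivative of a function that vanishes on `{r = 0}` to that set: only the
normal derivatives of `r` on the zero set contribute to the limit. -/
theorem IsCRMeasure.setIntegral_fieldDeriv_eq_zero [IsFiniteMeasureOnCompacts μ] {n : ℕ}
    {S : CRStructure N X n} {σ : ComplexMeasure X} [σ.variation.Regular]
    (hσ : IsCRMeasure S μ σ) {Z : ∀ x : X, ComplexTangentSpace N x}
    (hZ : IsSmoothFieldOn Z Set.univ) (hZS : ∀ x, Z x ∈ S.T01 x) {φ ψ : X → ℂ}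
    (hφ : IsTestFunction N φ) (h : IsFormalAdjointValue μ Z φ ψ) {r : X → F}
    (hr : ContMDiff (𝓡 N) 𝓘(ℝ, F) ∞ r) (ℓ : F →L[ℝ] ℂ) :
    ∫ᵛ x in {x | r x = 0}, φ x * fieldDeriv Z (fun y => ℓ (r y)) x
      ∂[ContinuousLinearMap.mul ℝ ℂ; σ] = 0 := by
  obtain ⟨G, hG, hGc, hGℓ⟩ := exists_contDiff_hasCompactSupport_eventuallyEq ℓ
  have hG0 : G 0 = 0 := by rw [hGℓ.eq_of_nhds, map_zero]
  have hG' : fderiv ℝ G 0 = ℓ := by rw [hGℓ.fderiv_eq, ℓ.fderiv]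
  have hdG : Continuous (fderiv ℝ G) := hG.continuous_fderiv (by simp)
  have hdGc : HasCompactSupport (fderiv ℝ G) := hGc.fderiv ℝ
  obtain ⟨C₀, hC₀⟩ := hGc.exists_bound_of_continuous hG.continuous
  obtain ⟨C₁, hC₁⟩ := hdGc.exists_bound_of_continuous hdG
  -- The `+ 1` keeps the scale nonzero and its inverse at most 1.
  let c : ℕ → ℝ := fun k => (k : ℝ) + 1
  have hc0 : ∀ k, c k ≠ 0 := fun k => by positivity
  -- The prefactor sends the function to zero, yet cancels the chain rule factor `c k`, so the
  -- derivatives keep a uniform bound.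
  let Gk : ℕ → F → ℂ := fun k v => (c k)⁻¹ • G (c k • v)
  have hGk : ∀ k, ContDiff ℝ ∞ (Gk k) := fun k =>
    (hG.comp (contDiff_const_smul (c k))).const_smul _
  have hGk' : ∀ k v, fderiv ℝ (Gk k) v = fderiv ℝ G (c k • v) := by
    intro k v
    have h1 : HasFDerivAt (fun v : F => c k • v) (c k • ContinuousLinearMap.id ℝ F) v :=
      (ContinuousLinearMap.id ℝ F).hasFDerivAt.const_smul (c k)
    have h2 := ((hG.differentiable (by simp) (c k • v)).hasFDerivAt.comp v h1).const_smul (c k)⁻¹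
    refine h2.fderiv.trans ?_
    ext w
    simp [hc0 k]
  have hgk : ∀ k, ContMDiff (𝓡 N) 𝓘(ℝ, ℂ) ∞ fun x => Gk k (r x) := fun k =>
    (hGk k).contMDiff.comp hr
  have hrd := hr.mdifferentiable (by simp)
  let p : X → F := fun x => tangentDeriv r x (rePart N x (Z x))
  let q : X → F := fun x => tangentDeriv r x (imPart N x (Z x))
  have hp : Continuous p := continuousOn_univ.1
    (contMDiffOn_tangentDeriv isOpen_univ hr.contMDiffOn hZ.1).continuousOn
  have hq : Continuous q := continuousOn_univ.1
    (contMDiffOn_tangentDeriv isOpen_univ hr.contMDiffOn hZ.2).continuousOn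
  have hZg : ∀ k x, fieldDeriv Z (fun y => Gk k (r y)) x =
      fderiv ℝ G (c k • r x) (p x) + Complex.I * fderiv ℝ G (c k • r x) (q x) := by
    intro k x
    rw [fieldDeriv_comp ((hGk k).differentiable (by simp) _) (hrd x), hGk']
  have hZℓ : ∀ x, fieldDeriv Z (fun y => ℓ (r y)) x = ℓ (p x) + Complex.I * ℓ (q x) := by
    intro x
    rw [fieldDeriv_comp ℓ.differentiableAt (hrd x), ℓ.fderiv]
  have hzero : MeasurableSet {x | r x = 0} :=
    (isClosed_singleton.preimage hr.continuous).measurableSet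
  have hφZ : ∀ k, ∫ᵛ x, ψ x * Gk k (r x) - φ x * fieldDeriv Z (fun y => Gk k (r y)) x
      ∂[ContinuousLinearMap.mul ℝ ℂ; σ] = 0 := fun k =>
    hσ Z hZ hZS _ _ (hφ.mul_right (hgk k)) (h.mul_right hZ hφ (hgk k))
  rw [← VectorMeasure.integral_indicator hzero, ← neg_eq_zero,
    ← VectorMeasure.integral_fun_neg]
  suffices hlim : Filter.Tendsto (fun k =>
      ∫ᵛ x, ψ x * Gk k (r x) - φ x * fieldDeriv Z (fun y => Gk k (r y)) x
        ∂[ContinuousLinearMap.mul ℝ ℂ; σ]) Filter.atTop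
      (nhds (∫ᵛ x, -Set.indicator {x | r x = 0}
        (fun x => φ x * fieldDeriv Z (fun y => ℓ (r y)) x) x
        ∂[ContinuousLinearMap.mul ℝ ℂ; σ])) by
    simp only [hφZ] at hlim
    exact (tendsto_nhds_unique tendsto_const_nhds hlim).symm
  refine VectorMeasure.tendsto_integral_of_dominated_convergence
    -- Independent of `k`, continuous and compactly supported: `C₀` bounds `G` and `C₁` bounds its
    -- differential.
    (fun x => ‖ψ x‖ * C₀ + ‖φ x‖ * (C₁ * ‖p x‖ + C₁ * ‖q x‖)) ?_ ?_ ?_ ?_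
  · intro k
    exact ((h.1.mul_right (hgk k)).1.continuous.sub
      (hφ.mul_right (contMDiff_fieldDeriv (hgk k) hZ)).1.continuous).aestronglyMeasurable
  · refine Continuous.integrable_of_hasCompactSupport ?_ ?_
    · have := h.1.1.continuous
      have := hφ.1.continuous
      fun_prop
    · exact h.1.2.norm.mul_right.add hφ.2.norm.mul_right
  · refine fun k => Filter.Eventually.of_forall fun x => ?_
    have h1 : ‖Gk k (r x)‖ ≤ C₀ := by
      have h2 : ‖(c k)⁻¹‖ ≤ 1 := by
        rw [norm_inv]
        refine inv_le_one_of_one_le₀ ?_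
        rw [Real.norm_eq_abs, abs_of_pos (by positivity)]
        simp [c]
      have h3 := hC₀ (c k • r x)
      calc ‖Gk k (r x)‖ = ‖(c k)⁻¹‖ * ‖G (c k • r x)‖ := norm_smul _ _
        _ ≤ 1 * C₀ := mul_le_mul h2 h3 (norm_nonneg _) zero_le_one
        _ = C₀ := one_mul _
    have h2 : ∀ w : F, ‖fderiv ℝ G (c k • r x) w‖ ≤ C₁ * ‖w‖ := fun w =>
      (ContinuousLinearMap.le_opNorm _ _).trans (by gcongr; exact hC₁ _)
    rw [hZg]
    refine (norm_sub_le _ _).trans (add_le_add ?_ ?_)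
    · rw [norm_mul]; gcongr
    · rw [norm_mul]
      gcongr
      refine (norm_add_le _ _).trans (add_le_add (h2 _) ?_)
      rw [norm_mul, Complex.norm_I, one_mul]
      exact h2 _
  -- On `{r = 0}` the sequence is constant. Elsewhere `c k • r x` eventually leaves the compact
  -- support of `G`, and both terms vanish.
  · refine Filter.Eventually.of_forall fun x => ?_
    simp only [hZg]
    by_cases hx : r x = 0
    · rw [Set.indicator_of_mem (by exact hx), hZℓ]
      simp only [Gk, hx, smul_zero, hG0, hG', mul_zero, zero_sub]
      exact tendsto_const_nhds
    · rw [Set.indicator_of_notMem (by exact hx)]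
      refine tendsto_const_nhds.congr' ?_
      obtain ⟨R, hR⟩ := hGc.isCompact.isBounded.exists_norm_le
      have hc : Filter.Tendsto (fun k => c k * ‖r x‖) Filter.atTop Filter.atTop :=
        (Filter.tendsto_atTop_add_const_right _ 1 tendsto_natCast_atTop_atTop).atTop_mul_const
          (norm_pos_iff.2 hx)
      filter_upwards [hc.eventually_gt_atTop R] with k hk
      have h1 : c k • r x ∉ tsupport G := by
        intro hmem
        have h2 := hR _ hmem
        rw [norm_smul, Real.norm_eq_abs, abs_of_pos (by positivity)] at h2
        linarith
      have h3 : fderiv ℝ G (c k • r x) = 0 :=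
        image_eq_zero_of_notMem_tsupport fun h => h1 (tsupport_fderiv_subset ℝ h)
      simp only [Gk, image_eq_zero_of_notMem_tsupport h1, h3, smul_zero, mul_zero,
        zero_apply, add_zero, sub_zero, neg_zero]

end LimitArgument

end CRGeometry

namespace CRGeometry

/-! ### Linear algebra of complexified tangent spaces -/

section ComplexTangent

variable {N : ℕ} {X : Type*} [TopologicalSpace X] [ChartedSpace (EuclideanSpace ℝ (Fin N)) X] {x : X}

theorem rePart_tmul (c : ℂ) (u : TangentSpace (𝓡 N) x) : rePart N x (c ⊗ₜ[ℝ] u) = c.re • u := rfl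

theorem imPart_tmul (c : ℂ) (u : TangentSpace (𝓡 N) x) : imPart N x (c ⊗ₜ[ℝ] u) = c.im • u := rfl

theorem conjTangent_tmul (c : ℂ) (u : TangentSpace (𝓡 N) x) :
    conjTangent N x (c ⊗ₜ[ℝ] u) = (starRingEnd ℂ c) ⊗ₜ[ℝ] u := rfl

theorem rePart_smul (c : ℂ) (z : ComplexTangentSpace N x) :
    rePart N x (c • z) = c.re • rePart N x z - c.im • imPart N x z := by
  induction z using TensorProduct.induction_on with
  | zero => simp
  | tmul d u =>
    rw [TensorProduct.smul_tmul', rePart_tmul, rePart_tmul, imPart_tmul, smul_eq_mul,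
      Complex.mul_re, sub_smul, mul_smul, mul_smul]
  | add a b ha hb => simp only [smul_add, map_add, ha, hb]; abel

theorem imPart_smul (c : ℂ) (z : ComplexTangentSpace N x) :
    imPart N x (c • z) = c.re • imPart N x z + c.im • rePart N x z := by
  induction z using TensorProduct.induction_on with
  | zero => simp
  | tmul d u =>
    rw [TensorProduct.smul_tmul', imPart_tmul, rePart_tmul, imPart_tmul, smul_eq_mul,
      Complex.mul_im, add_smul, mul_smul, mul_smul]
  | add a b ha hb => simp only [smul_add, map_add, ha, hb]; abel

theorem rePart_conjTangent (z : ComplexTangentSpace N x) :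
    rePart N x (conjTangent N x z) = rePart N x z := by
  induction z using TensorProduct.induction_on with
  | zero => simp
  | tmul d u => rw [conjTangent_tmul, rePart_tmul, rePart_tmul, Complex.conj_re]
  | add a b ha hb => simp only [map_add, ha, hb]

theorem imPart_conjTangent (z : ComplexTangentSpace N x) :
    imPart N x (conjTangent N x z) = -imPart N x z := by
  induction z using TensorProduct.induction_on with
  | zero => simp
  | tmul d u => rw [conjTangent_tmul, imPart_tmul, imPart_tmul, Complex.conj_im, neg_smul]
  | add a b ha hb => simp only [map_add, ha, hb]; abel

theorem conjTangent_conjTangent (z : ComplexTangentSpace N x) :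
    conjTangent N x (conjTangent N x z) = z := by
  induction z using TensorProduct.induction_on with
  | zero => simp
  | tmul d u => rw [conjTangent_tmul, conjTangent_tmul, Complex.conj_conj]
  | add a b ha hb => simp only [map_add, ha, hb]

theorem toComplexTangent_rePart_imPart (z : ComplexTangentSpace N x) :
    toComplexTangent (rePart N x z) (imPart N x z) = z := by
  induction z using TensorProduct.induction_on with
  | zero => simp [toComplexTangent]
  | tmul d u =>
    rw [toComplexTangent, rePart_tmul, imPart_tmul, ← TensorProduct.smul_tmul,
      ← TensorProduct.smul_tmul, ← TensorProduct.add_tmul]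
    congr 1
    apply Complex.ext <;> simp
  | add a b ha hb =>
    conv_rhs => rw [← ha, ← hb]
    simp only [toComplexTangent, map_add, TensorProduct.tmul_add]
    abel

theorem conjTangent_eq_neg_of_rePart_eq_zero {z : ComplexTangentSpace N x}
    (hz : rePart N x z = 0) : conjTangent N x z = -z := by
  rw [← toComplexTangent_rePart_imPart z, hz]
  simp only [toComplexTangent, TensorProduct.tmul_zero, zero_add, conjTangent_tmul,
    Complex.conj_I, TensorProduct.neg_tmul]

end ComplexTangent

/-! ### Rank of the horizontal bundle and global CR sections -/

section CRStructures

variable {N n : ℕ} {X : Type*} [TopologicalSpace X] [ChartedSpace (EuclideanSpace ℝ (Fin N)) X]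
  [IsManifold (𝓡 N) ∞ X] (S : CRStructure N X n)

theorem CRStructure.finrank_T10 (x : X) : Module.finrank ℂ (S.T10 x) = n := by
  obtain ⟨U, -, hxU, Z, -, hZ⟩ := S.exists_local_frame x
  rw [← (hZ x hxU).2, finrank_span_eq_card (hZ x hxU).1, Fintype.card_fin]

/-- Conjugation negates a purely imaginary vector, which therefore lies in both T_{1,0} and its
conjugate. -/
theorem CRStructure.eq_zero_of_rePart_eq_zero {x : X} {z : ComplexTangentSpace N x}
    (hz : z ∈ S.T10 x) (h : rePart N x z = 0) : z = 0 := by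
  refine Submodule.disjoint_def.1 (S.disjoint_conj x) z hz ?_
  change conjTangent N x z ∈ S.T10 x
  rw [conjTangent_eq_neg_of_rePart_eq_zero h]
  exact (S.T10 x).neg_mem hz

theorem CRStructure.finrank_horizontal (x : X) : Module.finrank ℝ (S.horizontal x) = 2 * n := by
  have h1 : S.horizontal x =
      LinearMap.range ((rePart N x).domRestrict ((S.T10 x).restrictScalars ℝ)) := by
    rw [LinearMap.range_domRestrict]; rfl
  rw [h1, LinearMap.finrank_range_of_inj]
  · have h2 : Module.finrank ℝ (S.T10 x) = 2 * Module.finrank ℂ (S.T10 x) :=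
      finrank_real_of_complex _
    rw [S.finrank_T10] at h2
    exact h2
  · rw [← LinearMap.ker_eq_bot, LinearMap.ker_eq_bot']
    intro z hz
    exact Subtype.ext (S.eq_zero_of_rePart_eq_zero z.2 hz)

/-- Through every point there are enough global smooth sections of `T_{0,1}X`. -/
theorem CRStructure.exists_global_sections [T2Space X] (x₀ : X) :
    ∃ Z : Fin n → ∀ x : X, ComplexTangentSpace N x,
      (∀ j, IsSmoothFieldOn (Z j) Set.univ) ∧ (∀ j x, Z j x ∈ S.T01 x) ∧
      Submodule.span ℂ (Set.range fun j => conjTangent N x₀ (Z j x₀)) = S.T10 x₀ := by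
  obtain ⟨U, hU, hxU, Z, hZs, hZ⟩ := S.exists_local_frame x₀
  obtain ⟨χ, hχ, -, hχs, hχ1, -⟩ := exists_contMDiff_cutoff
    (IsManifold.chart_mem_maximalAtlas (I := 𝓡 N) (n := ∞) x₀) isCompact_singleton
    (hU.inter (chartAt (EuclideanSpace ℝ (Fin N)) x₀).open_source)
    (Set.singleton_subset_iff.2 ⟨hxU, mem_chart_source _ x₀⟩) Set.inter_subset_right
  have hχU : tsupport χ ⊆ U := hχs.trans Set.inter_subset_left
  have hχ0 : χ x₀ = 1 := by
    rw [nhdsSet_singleton] at hχ1; exact hχ1.self_of_nhds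
  refine ⟨fun j x => χ x • conjTangent N x (Z j x), fun j => ⟨?_, ?_⟩, fun j x => ?_, ?_⟩
  · have h1 := ContMDiffOn.smul_section_of_tsupport hχ.contMDiffOn hU hχU (hZs j).1
    refine (h1.congr fun x => ?_).contMDiffOn
    simp only [map_smul, rePart_conjTangent]
    rfl
  -- Conjugation negates the imaginary part; the sign is absorbed into the cutoff.
  · have h1 := ContMDiffOn.smul_section_of_tsupport (ψ := fun x => -χ x) hχ.neg.contMDiffOn hU
      (by rwa [show (fun x => -χ x) = -χ from rfl, tsupport_neg]) (hZs j).2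
    refine (h1.congr fun x => ?_).contMDiffOn
    simp only [map_smul, imPart_conjTangent, smul_neg, ← neg_smul]
    rfl
  · change conjTangent N x (χ x • conjTangent N x (Z j x)) ∈ S.T10 x
    rw [map_smul, conjTangent_conjTangent]
    by_cases hx : x ∈ U
    · refine ((S.T10 x).restrictScalars ℝ).smul_mem _ ?_
      change Z j x ∈ S.T10 x
      rw [← (hZ x hx).2]
      exact Submodule.subset_span ⟨j, rfl⟩
    · rw [image_eq_zero_of_notMem_tsupport fun h => hx (hχU h), zero_smul]
      exact Submodule.zero_mem _
  · simp only [hχ0, one_smul, conjTangent_conjTangent]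
    exact (hZ x₀ hxU).2

end CRStructures

/-! ### Horizontal vectors are tangent at support points -/

section Vanishing

variable {N n : ℕ} {X : Type*} [TopologicalSpace X] [T2Space X]
  [ChartedSpace (EuclideanSpace ℝ (Fin N)) X] [IsManifold (𝓡 N) ∞ X]
  [MeasurableSpace X] [BorelSpace X] {S : CRStructure N X n} {μ : Measure X}
  {F : Type*} [NormedAddCommGroup F] [NormedSpace ℝ F] [FiniteDimensional ℝ F]

/-- Near `x₀` the function h = Z(ℓ ∘ r) is invertible, so φ = χ/h is a test function for every
cutoff χ. The limit identity then reads ∫_M χ dσ = 0, and cutoffs suffice to detect the measure. -/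
theorem IsCRMeasure.notMem_support_of_fieldDeriv_ne_zero (hμ : IsSmoothPositiveMeasure N μ)
    {σ : ComplexMeasure X} [σ.variation.Regular] (hσ : IsCRMeasure S μ σ)
    {M W : Set X} (hM : MeasurableSet M) [(σ.restrict M).variation.Regular] (hW : IsOpen W)
    {r : X → F} (hr : ContMDiff (𝓡 N) 𝓘(ℝ, F) ∞ r) (hMr : M ∩ W = {x | r x = 0} ∩ W)
    {Z : ∀ x : X, ComplexTangentSpace N x} (hZ : IsSmoothFieldOn Z Set.univ)
    (hZS : ∀ x, Z x ∈ S.T01 x) (ℓ : F →L[ℝ] ℂ) {x₀ : X} (hx₀ : x₀ ∈ W)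
    (h0 : fieldDeriv Z (fun y => ℓ (r y)) x₀ ≠ 0) :
    x₀ ∉ (σ.restrict M).variation.support := by
  have := hμ.isFiniteMeasureOnCompacts
  let e := chartAt (EuclideanSpace ℝ (Fin N)) x₀
  have he : e ∈ IsManifold.maximalAtlas (𝓡 N) ∞ X := IsManifold.chart_mem_maximalAtlas x₀
  set h : X → ℂ := fieldDeriv Z (fun y => ℓ (r y)) with hdef
  have hh : ContMDiff (𝓡 N) 𝓘(ℝ, ℂ) ∞ h := contMDiff_fieldDeriv (ℓ.contMDiff.comp hr) hZ
  have hne : IsOpen {x | h x ≠ 0} := isOpen_ne.preimage hh.continuous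
  set W' : Set X := W ∩ e.source ∩ {x | h x ≠ 0} with hW'
  have hW'o : IsOpen W' := (hW.inter e.open_source).inter hne
  rw [Measure.notMem_support_iff_exists]
  refine ⟨W', hW'o.mem_nhds ⟨⟨hx₀, mem_chart_source _ x₀⟩, h0⟩, ?_⟩
  refine variation_eq_zero_of_forall_integral hW'o fun K V hK hV hKV hVW => ?_
  obtain ⟨χ, hχ, hχc, hχs, hχ1, hχI⟩ := exists_contMDiff_cutoff he hK hV hKV
    (fun x hx => (hVW hx).1.2)
  have hχ0 : ∀ x ∉ V, χ x = 0 := fun x hx => image_eq_zero_of_notMem_tsupport fun h => hx (hχs h)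
  have hinv : ContMDiffOn (𝓡 N) 𝓘(ℝ, ℂ) ∞ (fun x => (h x)⁻¹) V := by
    intro x hx
    exact ((contDiffAt_inv ℝ (hVW hx).2).contMDiffAt.comp x hh.contMDiffAt).contMDiffWithinAt
  have hφ : IsTestFunction N fun x => χ x • (h x)⁻¹ :=
    ⟨contMDiff_smul_of_tsupport hχ hV hχs hinv, hχc.smul_right⟩
  have hφe : tsupport (fun x => χ x • (h x)⁻¹) ⊆ e.source :=
    (closure_mono (Function.support_smul_subset_left χ _)).trans
      (hχs.trans fun x hx => (hVW hx).1.2)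
  obtain ⟨ψ, hψ⟩ := exists_isFormalAdjointValue hμ he hZ hφ hφe
  have hint := hσ.setIntegral_fieldDeriv_eq_zero hZ hZS hφ hψ hr ℓ
  refine ⟨fun x => (χ x : ℂ), Complex.continuous_ofReal.comp hχ.continuous,
    fun x hx => ?_, fun x => ?_, fun x hx => by simp [hχ0 x hx], ?_⟩
  · simp only [hχ1.self_of_nhdsSet x hx, Complex.ofReal_one]
  · rw [Complex.norm_real, Real.norm_eq_abs, abs_of_nonneg (hχI x).1]
    exact (hχI x).2
  · have hr0 : MeasurableSet {x | r x = 0} :=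
      (isClosed_singleton.preimage hr.continuous).measurableSet
    rw [← hint, ← VectorMeasure.integral_indicator hM, ← VectorMeasure.integral_indicator hr0]
    congr 1
    ext x
    by_cases hx : x ∈ V
    · have hxW := hVW hx
      have h1 : x ∈ M ↔ r x = 0 := by
        have := Set.ext_iff.1 hMr x
        simpa [hxW.1.1] using this
      have h2 : χ x • (h x)⁻¹ * h x = χ x := by
        rw [Complex.real_smul, mul_assoc, inv_mul_cancel₀ hxW.2, mul_one]
      by_cases hxM : x ∈ M
      · rw [Set.indicator_of_mem hxM, Set.indicator_of_mem (by exact h1.1 hxM)]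
        exact h2.symm
      · rw [Set.indicator_of_notMem hxM, 
          Set.indicator_of_notMem (show x ∉ {x | r x = 0} from fun h => hxM (h1.2 h))]
    · rw [Set.indicator_apply_eq_zero.2 fun _ => by rw [hχ0 x hx, Complex.ofReal_zero],
        Set.indicator_apply_eq_zero.2 fun _ => by rw [hχ0 x hx, zero_smul, zero_mul]]

/-- At a support point of the restriction of a CR measure to `{r = 0}`, the horizontal bundle
is tangent to `{r = 0}`. -/
theorem IsCRMeasure.tangentDeriv_eq_zero_of_mem_horizontal (hμ : IsSmoothPositiveMeasure N μ)
    {σ : ComplexMeasure X} [σ.variation.Regular] (hσ : IsCRMeasure S μ σ)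
    {M W : Set X} (hM : MeasurableSet M) [(σ.restrict M).variation.Regular] (hW : IsOpen W)
    {r : X → F} (hr : ContMDiff (𝓡 N) 𝓘(ℝ, F) ∞ r) (hMr : M ∩ W = {x | r x = 0} ∩ W)
    {x₀ : X} (hx₀ : x₀ ∈ W) (hsupp : x₀ ∈ (σ.restrict M).variation.support)
    {v : TangentSpace (𝓡 N) x₀} (hv : v ∈ S.horizontal x₀) : tangentDeriv r x₀ v = 0 := by
  obtain ⟨Z, hZ, hZS, hspan⟩ := S.exists_global_sections x₀
  obtain ⟨z, hz, rfl⟩ := hv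
  have hz' : z ∈ Submodule.span ℂ (Set.range fun j => conjTangent N x₀ (Z j x₀)) := by
    rw [hspan]; exact hz
  -- Both parts are carried through the span induction because complex scalars mix them.
  suffices h : tangentDeriv r x₀ (rePart N x₀ z) = 0 ∧ tangentDeriv r x₀ (imPart N x₀ z) = 0
    from h.1
  clear hz
  induction hz' using Submodule.span_induction with
  | mem z hz =>
    obtain ⟨j, rfl⟩ := hz
    -- With `ℓ` real-valued, the real and imaginary parts of Z(ℓ ∘ r) are the derivatives along the
    -- two parts of Z, so both vanish.
    have hℓ : ∀ ℓ : F →L[ℝ] ℝ, ℓ (tangentDeriv r x₀ (rePart N x₀ (Z j x₀))) = 0 ∧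
        ℓ (tangentDeriv r x₀ (imPart N x₀ (Z j x₀))) = 0 := by
      intro ℓ
      by_contra hne
      refine hσ.notMem_support_of_fieldDeriv_ne_zero hμ hM hW hr hMr (hZ j) (hZS j)
        (Complex.ofRealCLM.comp ℓ) hx₀ (fun h0 => hne ?_) hsupp
      rw [fieldDeriv_comp (ContinuousLinearMap.differentiableAt _)
        (hr.mdifferentiable (by simp) x₀), ContinuousLinearMap.fderiv] at h0
      simp only [ContinuousLinearMap.comp_apply, Complex.ofRealCLM_apply] at h0
      constructor
      · simpa using congrArg Complex.re h0
      · simpa using congrArg Complex.im h0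
    rw [rePart_conjTangent, imPart_conjTangent, map_neg, neg_eq_zero]
    refine ⟨?_, ?_⟩ <;> by_contra hne
    · obtain ⟨ℓ, h⟩ := SeparatingDual.exists_ne_zero (R := ℝ) hne
      exact h (hℓ ℓ).1
    · obtain ⟨ℓ, h⟩ := SeparatingDual.exists_ne_zero (R := ℝ) hne
      exact h (hℓ ℓ).2
  | zero => simp
  | add a b _ _ ha hb => simp [map_add, ha.1, ha.2, hb.1, hb.2]
  | smul c a _ ha => simp [rePart_smul, imPart_smul, map_add, map_sub, map_smul, ha.1, ha.2]

end Vanishing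

end CRGeometry

namespace CRGeometry

/-! ### Local defining functions of embedded submanifolds -/

section Submanifolds

variable {N d : ℕ} {X : Type*} [TopologicalSpace X] [T2Space X]
  [ChartedSpace (EuclideanSpace ℝ (Fin N)) X]
  {M : Type*} [TopologicalSpace M] [ChartedSpace (EuclideanSpace ℝ (Fin d)) M]

omit [T2Space X] in
theorem mdifferentiable_of_mem_maximalAtlas
    {e : OpenPartialHomeomorph X (EuclideanSpace ℝ (Fin N))}
    (he : e ∈ IsManifold.maximalAtlas (𝓡 N) ∞ X) : e.MDifferentiable (𝓡 N) (𝓡 N) :=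
  ⟨(contMDiffOn_of_mem_maximalAtlas he).mdifferentiableOn (by simp),
    (contMDiffOn_symm_of_mem_maximalAtlas he).mdifferentiableOn (by simp)⟩

/-- An embedded submanifold is locally the zero set of a smooth function whose derivative
vanishes only on the tangent space. -/
theorem exists_local_defining_function {ι : M → X}
    (hι : Manifold.IsSmoothEmbedding (𝓡 d) (𝓡 N) ∞ ι) (p : M) :
    ∃ (F : Type) (_ : NormedAddCommGroup F) (_ : NormedSpace ℝ F) (_ : FiniteDimensional ℝ F)
      (r : X → F) (W : Set X), ContMDiff (𝓡 N) 𝓘(ℝ, F) ∞ r ∧ IsOpen W ∧ ι p ∈ W ∧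
      Set.range ι ∩ W = {x | r x = 0} ∩ W ∧
      ∀ v : TangentSpace (𝓡 N) (ι p), tangentDeriv r (ι p) v = 0 →
        v ∈ (mfderiv (𝓡 d) (𝓡 N) ι p).range := by
  obtain ⟨F, _, _, hF⟩ := hι.isImmersion
  have hp := hF p
  set c := hp.domChart with hcdef
  set e := hp.codChart with hedef
  set L := hp.equiv with hLdef
  have hpc : p ∈ c.source := hp.mem_domChart_source
  have hpe : ι p ∈ e.source := hp.mem_codChart_source
  have hc : c ∈ IsManifold.maximalAtlas (𝓡 d) ∞ M := hp.domChart_mem_maximalAtlas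
  have he : e ∈ IsManifold.maximalAtlas (𝓡 N) ∞ X := hp.codChart_mem_maximalAtlas
  have hse : ∀ q ∈ c.source, ι q ∈ e.source := fun q hq => hp.source_subset_preimage_source hq
  -- Immersion normal form: in these charts `ι` is the inclusion of the first factor, followed by
  -- the linear isomorphism `L`.
  have hL : ∀ q ∈ c.source, e (ι q) = L (c q, 0) := by
    intro q hq
    have hqt : c q ∈ (c.extend (𝓡 d)).target := by
      simpa [OpenPartialHomeomorph.extend] using c.map_source hq
    have h1 := hp.writtenInCharts hqt
    simpa [← hcdef, ← hedef, c.left_inv hq] using h1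
  have hfin : FiniteDimensional ℝ F := by
    have h1 : FiniteDimensional ℝ (EuclideanSpace ℝ (Fin d) × F) :=
      L.symm.toLinearEquiv.finiteDimensional
    exact Module.Finite.of_surjective (LinearMap.snd ℝ (EuclideanSpace ℝ (Fin d)) F)
      LinearMap.snd_surjective
  -- The transverse coordinate; cut off, `P ∘ e` is the defining function.
  let P : EuclideanSpace ℝ (Fin N) →L[ℝ] F :=
    (ContinuousLinearMap.snd ℝ (EuclideanSpace ℝ (Fin d)) F).comp
      (L.symm : EuclideanSpace ℝ (Fin N) →L[ℝ] EuclideanSpace ℝ (Fin d) × F)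
  have hP : ∀ y, P y = (L.symm y).2 := fun y => rfl
  obtain ⟨χ, hχ, -, hχs, hχ1, -⟩ := exists_contMDiff_cutoff he isCompact_singleton
    e.open_source (Set.singleton_subset_iff.2 hpe) subset_rfl
  rw [nhdsSet_singleton] at hχ1
  obtain ⟨W₁, hW₁, hW₁o, hpW₁⟩ := eventually_nhds_iff.1 hχ1
  -- Embeddedness enters here: inside `W₂` the image has no points coming from outside the domain of
  -- `c`.
  obtain ⟨W₂, hW₂o, hW₂⟩ := hι.isEmbedding.isInducing.isOpen_iff.1 c.open_source
  -- Keeping the tangential coordinate in `c.target` ensures that every zero of the transverse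
  -- coordinate lies in the image of `ι`.
  have hW₃o : IsOpen (e.source ∩ e ⁻¹' {y | (L.symm y).1 ∈ c.target}) :=
    e.isOpen_inter_preimage (c.open_target.preimage (continuous_fst.comp L.symm.continuous))
  have hPe : ContMDiffOn (𝓡 N) 𝓘(ℝ, F) ∞ (fun x => P (e x)) e.source :=
    P.contMDiff.comp_contMDiffOn (contMDiffOn_of_mem_maximalAtlas he)
  refine ⟨F, _, _, hfin, fun x => χ x • P (e x),
    W₁ ∩ W₂ ∩ (e.source ∩ e ⁻¹' {y | (L.symm y).1 ∈ c.target}),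
    contMDiff_smul_of_tsupport hχ e.open_source hχs hPe,
    (hW₁o.inter hW₂o).inter hW₃o, ⟨⟨hpW₁, ?_⟩, hpe, ?_⟩, ?_, fun v hv => ?_⟩
  · change p ∈ ι ⁻¹' W₂
    rwa [hW₂]
  · change (L.symm (e (ι p))).1 ∈ c.target
    rw [hL p hpc, L.symm_apply_apply]
    exact c.map_source hpc
  · ext x
    simp only [Set.mem_inter_iff, Set.mem_ofPred_eq, and_congr_left_iff]
    rintro ⟨⟨hx1, hx2⟩, hx3, hx4⟩
    rw [hW₁ x hx1, one_smul, hP]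
    constructor
    · rintro ⟨q, rfl⟩
      have hq : q ∈ c.source := by rw [← hW₂]; exact hx2
      rw [hL q hq, L.symm_apply_apply]
    · intro h0
      have hx4' : (L.symm (e x)).1 ∈ c.target := hx4
      have hq := c.map_target hx4'
      refine ⟨c.symm (L.symm (e x)).1, e.injOn (hse _ hq) hx3 ?_⟩
      rw [hL _ hq, c.right_inv hx4', ← h0, Prod.mk.eta, L.apply_symm_apply]
  · have hcd := mdifferentiable_of_mem_maximalAtlas hc
    have hed := mdifferentiable_of_mem_maximalAtlas he
    have hv1 : P (tangentDeriv (F := EuclideanSpace ℝ (Fin N)) e (ι p) v) = 0 := by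
      have h1 : (fun x => χ x • P (e x)) =ᶠ[nhds (ι p)] fun x => P (e x) := by
        filter_upwards [hχ1] with x hx
        rw [hx, one_smul]
      have h2 := h1.mfderiv_eq (I := 𝓡 N) (I' := 𝓘(ℝ, F))
      have h3 : tangentDeriv (fun x => P (e x)) (ι p) v = 0 :=
        (congrArg (fun L => L v) h2).symm.trans hv
      rwa [tangentDeriv_comp P.differentiableAt (hed.mdifferentiableAt hpe), P.fderiv] at h3
    -- Choose `w` with the tangential coordinates of `v`. The transverse ones vanish by `hv1`, so
    -- the images of `w` and `v` agree in the chart `e`, whose differential is injective.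
    obtain ⟨w, hw⟩ := hcd.mfderiv_surjective hpc
      (L.symm (tangentDeriv (F := EuclideanSpace ℝ (Fin N)) e (ι p) v)).1
    refine ⟨w, hed.mfderiv_injective hpe ?_⟩
    have hιd : MDifferentiableAt (𝓡 d) (𝓡 N) ι p := hι.contMDiff.mdifferentiable (by simp) p
    let J : EuclideanSpace ℝ (Fin d) →L[ℝ] EuclideanSpace ℝ (Fin N) :=
      (L : EuclideanSpace ℝ (Fin d) × F →L[ℝ] EuclideanSpace ℝ (Fin N)).comp
        (ContinuousLinearMap.inl ℝ (EuclideanSpace ℝ (Fin d)) F)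
    have h1 : (fun q => e (ι q)) =ᶠ[nhds p] fun q => J (c q) := by
      filter_upwards [c.open_source.mem_nhds hpc] with q hq
      exact hL q hq
    have h2 : tangentDeriv (F := EuclideanSpace ℝ (Fin N)) (fun q => e (ι q)) p w =
        J (tangentDeriv (F := EuclideanSpace ℝ (Fin d)) c p w) := by
      have h3 := h1.mfderiv_eq (I := 𝓡 d) (I' := 𝓡 N)
      refine (congrArg (fun L => L w) h3).trans ?_
      have h4 := tangentDeriv_comp (G := J) (r := c) J.differentiableAt
        (hcd.mdifferentiableAt hpc) w
      rwa [J.fderiv] at h4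
    have h5 := congrArg (fun L => L w) (mfderiv_comp p (hed.mdifferentiableAt hpe) hιd)
    refine (h5.symm.trans h2).trans ?_
    have h6 : tangentDeriv (F := EuclideanSpace ℝ (Fin d)) c p w =
      (L.symm (tangentDeriv (F := EuclideanSpace ℝ (Fin N)) e (ι p) v)).1 := hw
    rw [h6]
    change L ((L.symm (tangentDeriv (F := EuclideanSpace ℝ (Fin N)) e (ι p) v)).1, (0 : F)) = _
    rw [← hv1, hP, Prod.mk.eta, L.apply_symm_apply]
    rfl

end Submanifolds

end CRGeometry

/-! ### The dimension count -/

theorem mainTheorem11 {n d : ℕ}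
    {X : Type*} [TopologicalSpace X] [T2Space X]
    [ChartedSpace (EuclideanSpace ℝ (Fin (2 * n + 1))) X] [IsManifold (𝓡 (2 * n + 1)) ∞ X]
    [MeasurableSpace X] [BorelSpace X]
    (S : CRGeometry.CRStructure (2 * n + 1) X n)
    (μ : Measure X) (hμ : CRGeometry.IsSmoothPositiveMeasure (2 * n + 1) μ)
    (σ : ComplexMeasure X) (hreg : σ.variation.Regular) (hCR : CRGeometry.IsCRMeasure S μ σ)
    {M : Type*} [TopologicalSpace M] [ConnectedSpace M]
    [ChartedSpace (EuclideanSpace ℝ (Fin d)) M] [IsManifold (𝓡 d) ∞ M]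
    (ι : M → X) (hι : Manifold.IsSmoothEmbedding (𝓡 d) (𝓡 (2 * n + 1)) ∞ ι)
    (hd : d < 2 * n + 1) (hσ : σ.restrict (Set.range ι) ≠ 0) :
    d + 1 = 2 * n + 1 ∧
      ∀ p : M, ι p ∈ (σ.restrict (Set.range ι)).variation.support →
        (mfderiv (𝓡 d) (𝓡 (2 * n + 1)) ι p).range = S.horizontal (ι p) := by
  obtain ⟨hM, hregM, _, ⟨p₀, rfl⟩, hp₀⟩ := CRGeometry.exists_mem_support_variation_restrict hσ
  have hle : ∀ p : M, ι p ∈ (σ.restrict (Set.range ι)).variation.support →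
      S.horizontal (ι p) ≤ (mfderiv (𝓡 d) (𝓡 (2 * n + 1)) ι p).range := by
    intro p hp v hv
    obtain ⟨F, _, _, _, r, W, hr, hW, hpW, hMW, hker⟩ :=
      CRGeometry.exists_local_defining_function hι p
    exact hker v (hCR.tangentDeriv_eq_zero_of_mem_horizontal hμ hM hW hr hMW hpW hp hv)
  have hfin : ∀ p : M, FiniteDimensional ℝ (TangentSpace (𝓡 (2 * n + 1)) (ι p)) := fun p =>
    inferInstanceAs (FiniteDimensional ℝ (EuclideanSpace ℝ (Fin (2 * n + 1))))
  have hfin' : ∀ p : M, FiniteDimensional ℝ (TangentSpace (𝓡 d) p) := fun p =>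
    inferInstanceAs (FiniteDimensional ℝ (EuclideanSpace ℝ (Fin d)))
  have hrank : ∀ p : M,
      Module.finrank ℝ (mfderiv (𝓡 d) (𝓡 (2 * n + 1)) ι p).range ≤ d := by
    intro p
    refine (LinearMap.finrank_range_le _).trans_eq ?_
    exact finrank_euclideanSpace_fin (𝕜 := ℝ) (n := d)
  -- At the support point `p₀`, 2n = dim H ≤ dim TM ≤ d < 2n + 1.
  have hdim : d = 2 * n := by
    have h1 := Submodule.finrank_mono (hle p₀ hp₀)
    rw [S.finrank_horizontal] at h1
    have h2 := hrank p₀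
    omega
  refine ⟨by omega, fun p hp => (Submodule.eq_of_le_of_finrank_le (hle p hp) ?_).symm⟩
  rw [S.finrank_horizontal]
  exact (hrank p).trans_eq hdim
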